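/- Let $\mathbb{F}_q$ be a finite field and let $F/\mathbb{F}_q$ be a function field, i.e. a finite extension of $\mathbb{F}_q(z)$ for some $z\in F$ transcendental over $\mathbb{F}_q$, with full constant field $\mathbb{F}_q$ (every element of $F$ algebraic over $\mathbb{F}_q$ lies in $\mathbb{F}_q$). Let $\sigma\in\mathrm{Aut}(F/\mathbb{F}_q)$ be an automorphism of finite order with fixed field $F^{\sigma}$; for a place $P$ and an automorphism $\tau$ put $P^{\tau}=\{\tau(f): f\in P\}$, and for a divisor $D=\sum_P m_P P$ put $D^{\tau}=\sum_P m_P P^{\tau}$. Let $Q'$ be a place of $F$ lying above a place $Q$ of $F^{\sigma}$ of degree $1$. Let $D\ge 0$ be a divisor of $F$ with $Q'\notin\mathrm{supp}(D)$ and $D^{\sigma}=D$, put $\ell=\deg D$, and let $\mathcal{V}$ be an $\mathbb{F}_q$-subspace of the Riemann–Roch space $\mathcal{L}(D)$ such that $\mathcal{V}\cap\mathcal{L}(D-Q')=\{0\}$. Let $r,s,t$ be natural numbers with $1\le s\le t$. For a place $P$ of $F$ put $S_P=\{P^{\sigma^{-i}}: 0\le i\le t-1\}$, and let $\mathcal{F}_r$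 be a set of places $P$ of $F$ of degree $r$, with $P\notin\mathrm{supp}(D)$ and $|S_P|=t$ for each $P\in\mathcal{F}_r$, such that the sets $S_P$ $(P\in\mathcal{F}_r)$ are pairwise disjoint. For $P\in\mathcal{F}_r$ let $$\mathcal{H}_P=\{f\in\mathcal{V}: f(P^{\sigma^{-i}})=0\text{ for all }0\le i\le t-1\},$$ where $f(P)$ denotes the residue class of $f$ modulo $P$. Then each $\mathcal{H}_P$, $P\in\mathcal{F}_r$, has codimension at most $rt$ in $\mathcal{V}$, and the collection $(\mathcal{H}_P)_{P\in\mathcal{F}_r}$ is an $\left(s,\frac{\ell s}{r(t-s+1)}\right)$-strong subspace design in $\mathcal{V}$: for every $s$-dimensional $\mathbb{F}_q$-subspace $\mathcal{W}\subseteq\mathcal{V}$, $$\sum_{P\in\mathcal{F}_r}\dim_{\mathbb{F}_q}(\mathcal{W}\cap\mathcal{H}_P)\le\frac{\ell s}{r(t-s+1)}.$$ -/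

import Mathlib

namespace AlgFunField

open scoped WithZero

/-- `F` is an algebraic function field of one variable over `k`: it is a finite extension of
`k(z)` for some `z ∈ F` that is transcendental over `k`. -/
def IsFunctionField (k F : Type*) [Field k] [Field F] [Algebra k F] : Prop :=
  ∃ z : F, Transcendental k z ∧ FiniteDimensional (IntermediateField.adjoin k {z}) F

/-- A place of `F/k`, represented by its valuation ring `O_P` (which determines, and is determined
by, its maximal ideal `P`): a discrete valuation ring containing `k`, with fraction field `F`. -/
@[ext]
structure Place (k F : Type*) [Field k] [Field F] [Algebra k F] where
  /-- The valuation ring `O_P`. -/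
  ring : ValuationSubring F
  isDVR : IsDiscreteValuationRing ring
  algebraMap_mem : ∀ a : k, algebraMap k F a ∈ ring

namespace Place

variable {k F : Type*} [Field k] [Field F] [Algebra k F]

instance (P : Place k F) : IsDiscreteValuationRing P.ring := P.isDVR

instance (P : Place k F) : Algebra k P.ring :=
  ((algebraMap k F).codRestrict P.ring.toSubring P.algebraMap_mem).toAlgebra

/-- The degree `[O_P / P : k]` of a place. -/
noncomputable def degree (P : Place k F) : ℕ :=
  Module.finrank k (IsLocalRing.ResidueField P.ring)

/-- The normalized discrete valuation of `P`, written multiplicatively: it takes the value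
`exp (-ν_P(f))` at `f ≠ 0` and the value `0` at `f = 0`. -/
noncomputable def valuation (P : Place k F) : Valuation F ℤᵐ⁰ :=
  (IsDiscreteValuationRing.maximalIdeal P.ring).valuation F

/-- `f` vanishes at `P`, that is, `f ∈ O_P` and the residue class `f(P)` in `O_P / P` is zero. -/
def VanishesAt (P : Place k F) (f : F) : Prop :=
  ∃ h : f ∈ P.ring, IsLocalRing.residue P.ring ⟨f, h⟩ = 0

/-- The conjugate place `P^τ = {f^τ : f ∈ P}`, with valuation ring `τ(O_P)`. -/
def conj (P : Place k F) (τ : F ≃ₐ[k] F) : Place k F where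
  ring := P.ring.comap (τ.symm : F →+* F)
  isDVR :=
    IsDiscreteValuationRing.RingEquivClass.isDiscreteValuationRing
      (A := P.ring) (B := P.ring.comap (τ.symm : F →+* F))
      ({
        toFun := fun x => ⟨τ x, by simp [ValuationSubring.mem_comap]⟩
        invFun := fun y => ⟨τ.symm y, y.2⟩
        left_inv := fun x => by simp
        right_inv := fun y => by simp
        map_mul' := fun x y => by ext; simp
        map_add' := fun x y => by ext; simp } : P.ring ≃+* P.ring.comap (τ.symm : F →+* F))
  algebraMap_mem a := by
    simpa [ValuationSubring.mem_comap] using P.algebraMap_mem a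

/-- The place `P'` of `F` lies above the place `Q` of the intermediate field `K`, that is,
`O_{P'} ∩ K = O_Q`. -/
def LiesAbove {K : IntermediateField k F} (P' : Place k F) (Q : Place k K) : Prop :=
  P'.ring.comap (algebraMap K F) = Q.ring

/-- `S_P = {P^{σ^{-i}} : 0 ≤ i ≤ t - 1}`. -/
def orbitSet (σ : F ≃ₐ[k] F) (t : ℕ) (P : Place k F) : Set (Place k F) :=
  {P' | ∃ i < t, P' = P.conj (σ ^ (-(i : ℤ)))}

lemma vanishesAt_iff (P : Place k F) (f : F) : P.VanishesAt f ↔ f ∈ P.ring.nonunits := by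
  rw [ValuationSubring.mem_nonunits_iff_exists_mem_maximalIdeal]
  simp [VanishesAt, IsLocalRing.residue_eq_zero_iff]

lemma mem_conj_iff (P : Place k F) (τ : F ≃ₐ[k] F) (f : F) :
    f ∈ (P.conj τ).ring ↔ τ.symm f ∈ P.ring := Iff.rfl

lemma valuation_le_one (P : Place k F) {f : F} (hf : f ∈ P.ring) : P.valuation f ≤ 1 :=
  (IsDiscreteValuationRing.maximalIdeal P.ring).valuation_le_one (K := F) ⟨f, hf⟩

lemma VanishesAt.smul {P : Place k F} {f : F} (hf : P.VanishesAt f) (c : k) :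
    P.VanishesAt (c • f) := by
  obtain ⟨h, h0⟩ := hf
  have hc := P.algebraMap_mem c
  have he : c • f = algebraMap k F c * f := Algebra.smul_def c f
  refine ⟨he ▸ P.ring.mul_mem _ _ hc h, ?_⟩
  have : (⟨c • f, he ▸ P.ring.mul_mem _ _ hc h⟩ : P.ring) =
      ⟨algebraMap k F c, hc⟩ * ⟨f, h⟩ := Subtype.ext he
  rw [this, map_mul, h0, mul_zero]

end Place

/-- A divisor of `F/k`: a finite formal integral combination of places. -/
abbrev Divisor (k F : Type*) [Field k] [Field F] [Algebra k F] := Place k F →₀ ℤ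

namespace Divisor

variable {k F : Type*} [Field k] [Field F] [Algebra k F]

/-- `deg D = ∑_P m_P deg P`. -/
noncomputable def degree (D : Divisor k F) : ℤ :=
  D.sum fun P m => m * (P.degree : ℤ)

/-- `D^τ = ∑_P m_P P^τ`. -/
noncomputable def conj (D : Divisor k F) (τ : F ≃ₐ[k] F) : Divisor k F :=
  D.mapDomain fun P => P.conj τ

/-- The Riemann–Roch space `L(D) = {f ≠ 0 : (f) + D ≥ 0} ∪ {0}`; the condition
`ν_P(f) ≥ -D(P)` is written multiplicatively. -/
noncomputable def rrSpace (D : Divisor k F) : Submodule k F where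
  carrier := {f | ∀ P : Place k F, P.valuation f ≤ WithZero.exp (D P)}
  zero_mem' := fun P => by simp
  add_mem' := fun hf hg P => (P.valuation.map_add _ _).trans (max_le (hf P) (hg P))
  smul_mem' := fun c f hf P => by
    rw [Algebra.smul_def, map_mul]
    exact (mul_le_of_le_one_left' (P.valuation_le_one (P.algebraMap_mem c))).trans (hf P)

end Divisor

section

variable {k F : Type*} [Field k] [Field F] [Algebra k F]

/-- `H_P = {f ∈ V : f(P^{σ^{-i}}) = 0 for 0 ≤ i ≤ t - 1}`, as a subspace of `V`. -/
def vanishingSubspace (V : Submodule k F) (σ : F ≃ₐ[k] F) (t : ℕ) (P : Place k F) :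
    Submodule k V where
  carrier := {f | ∀ i < t, (P.conj (σ ^ (-(i : ℤ)))).VanishesAt (f : F)}
  zero_mem' := fun i _ => by
    rw [Place.vanishesAt_iff]; exact zero_mem _
  add_mem' := fun hf hg i hi => by
    rw [Place.vanishesAt_iff]
    exact add_mem ((Place.vanishesAt_iff _ _).1 (hf i hi)) ((Place.vanishesAt_iff _ _).1 (hg i hi))
  smul_mem' := fun c _ hf i hi => (hf i hi).smul c

end

/-- A collection `(H_i)` of subspaces of a `k`-vector space `V` is an `(s, L)`-strong subspace
design if `∑_i dim (W ∩ H_i) ≤ L` for every `s`-dimensional subspace `W` of `V`. The sum of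
nonnegative terms over all `i` is bounded through its finite partial sums, so that no finiteness
of the index type is presupposed. -/
def IsStrongSubspaceDesign {k V ι : Type*} [Field k] [AddCommGroup V] [Module k V]
    (H : ι → Submodule k V) (s : ℕ) (L : ℝ) : Prop :=
  ∀ W : Submodule k V, FiniteDimensional k W → Module.finrank k W = s →
    ∀ T : Finset ι, ∑ i ∈ T, (Module.finrank k ↥(W ⊓ H i) : ℝ) ≤ L

end AlgFunField

/-! The proof uses the Casorati determinant `Δ = det (σ ^ j (f i))` of a basis `f` of `W`, a
difference analogue of the Wronskian.

It is nonzero because `f` is independent over the fixed field of `σ`: a relation, scaled and reduced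
modulo the rational place `Q`, would give a nontrivial `k`-combination vanishing at `Q'`, which the
condition on `V` excludes (`linearIndependent_of_rational_place`, `det_pow_apply_ne_zero`). Since
`D` is `σ`-invariant, all entries of the matrix lie in `L(D)`, so `Δ ∈ L(sD)`.

For `0 ≤ i ≤ t - s`, the value of `σ ^ j (f l)` at `P^{σ^{-i}}` is governed by that of `f l` at
`P^{σ^{-(i+j)}}`, and `i + j ≤ t - 1`. In a basis adapted to `W ∩ H_P`, a whole row vanishes for
each basis vector of `W ∩ H_P`, so `Δ` has order at least `dim (W ∩ H_P)` there
(`valuation_det_casorati_le`). These places are distinct and of degree `r`, so counting the zeros of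
`Δ` gives `r (t - s + 1) ∑ dim (W ∩ H_P) ≤ s deg D`.

The zero count (`IsFunctionField.sum_mul_degree_le_degree`) compares both sides with `[F : k(f)]`:
weak approximation bounds the zeros of a transcendental `f` by it, and the growth of `dim L(E + lG)`
in `l` bounds it by `deg G`. -/

namespace AlgFunField

open scoped WithZero
open WithZero

/-! ### Normalized discrete valuations. -/

section IntegerValued

variable {K : Type*} [Field K]

lemma lt_one_iff_le_exp_neg_one {a : ℤᵐ⁰} : a < 1 ↔ a ≤ exp (-1) := by
  rcases eq_or_ne a 0 with rfl | ha
  · simp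
  · rw [← exp_zero, ← log_lt_iff_lt_exp ha, ← log_le_iff_le_exp ha]; omega

lemma Valuation.eq_one_iff_of_le_one_iff {Γ Γ' : Type*} [LinearOrderedCommGroupWithZero Γ]
    [LinearOrderedCommGroupWithZero Γ'] {v : Valuation K Γ} {w : Valuation K Γ'}
    (h : ∀ x, v x ≤ 1 ↔ w x ≤ 1) (x : K) : v x = 1 ↔ w x = 1 := by
  rcases eq_or_ne x 0 with rfl | hx
  · simp
  have hv : 0 < v x := zero_lt_iff.2 ((Valuation.ne_zero_iff _).2 hx)
  have hw : 0 < w x := zero_lt_iff.2 ((Valuation.ne_zero_iff _).2 hx)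
  rw [le_antisymm_iff, le_antisymm_iff, ← inv_le_one₀ hv, ← inv_le_one₀ hw, ← map_inv₀,
    ← map_inv₀, h, h]

/-- Two normalized discrete valuations with the same valuation ring agree. -/
lemma Valuation.ext_of_le_one_iff {v w : Valuation K ℤᵐ⁰} (h : ∀ x, v x ≤ 1 ↔ w x ≤ 1)
    (hv : ∃ x, v x = exp (-1)) (hw : ∃ x, w x = exp (-1)) : v = w := by
  have h1 := Valuation.eq_one_iff_of_le_one_iff h
  have hlt (x : K) : v x < 1 ↔ w x < 1 := by
    rw [lt_iff_le_and_ne, lt_iff_le_and_ne, h, Ne, Ne, h1]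
  obtain ⟨x, hx⟩ := hv
  obtain ⟨y, hy⟩ := hw
  have hx0 : x ≠ 0 := by rintro rfl; exact absurd hx.symm (by simp)
  have hy0 : y ≠ 0 := by rintro rfl; exact absurd hy.symm (by simp)
  have hpow {u : Valuation K ℤᵐ⁰} {a b : K} (ha : u a = exp (-1)) (hb : b ≠ 0) :
      u (b * a ^ (log (u b))) = 1 := by
    have : u b ≠ 0 := (Valuation.ne_zero_iff _).2 hb
    rw [map_mul, map_zpow₀, ha, ← exp_zsmul]
    conv_lhs => enter [1]; rw [← exp_log this]
    rw [← exp_add]; simp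
  have hwx : w x ≤ exp (-1) := lt_one_iff_le_exp_neg_one.1 ((hlt x).1 (by rw [hx]; decide))
  have hvy : v y ≤ exp (-1) := lt_one_iff_le_exp_neg_one.1 ((hlt y).2 (by rw [hy]; decide))
  have hwx0 : w x ≠ 0 := (Valuation.ne_zero_iff _).2 hx0
  have hvy0 : v y ≠ 0 := (Valuation.ne_zero_iff _).2 hy0
  have e1 : log (w x) ≤ -1 := (log_le_iff_le_exp hwx0).2 hwx
  have e2 : log (v y) ≤ -1 := (log_le_iff_le_exp hvy0).2 hvy
  -- This element is a unit for `w`, hence for `v`. So the integers `log (w x)` and `log (v y)`,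
  -- both at most `-1`, have product `1`, and both equal `-1`.
  have e3 : v (x * y ^ (log (w x))) = 1 := (h1 _).2 (hpow hy hx0)
  have e4 : log (v x) + log (w x) * log (v y) = 0 := by
    have := congrArg log e3
    rwa [map_mul, map_zpow₀, log_mul (by simp [hx]) (zpow_ne_zero _ hvy0), log_zpow, log_one,
      smul_eq_mul] at this
  rw [hx, log_exp] at e4
  have e5 : log (w x) = -1 := by nlinarith
  have hwx1 : w x = exp (-1) := by rw [← e5, exp_log hwx0]
  ext f
  rcases eq_or_ne f 0 with rfl | hf
  · simp
  have e6 := (h1 _).1 (hpow hx hf)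
  have hvf : v f ≠ 0 := (Valuation.ne_zero_iff _).2 hf
  have hwf : w f ≠ 0 := (Valuation.ne_zero_iff _).2 hf
  have e7 := congrArg log e6
  rw [map_mul, map_zpow₀, log_mul hwf (zpow_ne_zero _ hwx0), log_zpow, log_one, hwx1, log_exp] at e7
  rw [← exp_log hvf, ← exp_log hwf]
  congr 1
  simp at e7; omega

end IntegerValued

/-- Valuation rings are integrally closed. -/
lemma mem_valuationSubring_of_isAlgebraic {k F : Type*} [Field k] [Field F] [Algebra k F]
    (O : ValuationSubring F) (hO : ∀ a : k, algebraMap k F a ∈ O) {f : F}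
    (hf : IsAlgebraic k f) : f ∈ O := by
  let _ : Algebra k O := ((algebraMap k F).codRestrict O.toSubring hO).toAlgebra
  have : IsScalarTower k O F := .of_algebraMap_eq fun _ => rfl
  obtain ⟨y, rfl⟩ := IsIntegrallyClosed.isIntegral_iff.1 (hf.isIntegral.tower_top (A := O))
  exact y.2

/-! ### Places: valuations, conjugation and degree. -/

namespace Place

variable {k F : Type*} [Field k] [Field F] [Algebra k F] (P : Place k F)

lemma mem_ring_iff {f : F} : f ∈ P.ring ↔ P.valuation f ≤ 1 := by
  refine ⟨P.valuation_le_one, fun h => ?_⟩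
  obtain ⟨a, rfl⟩ := IsDiscreteValuationRing.exists_lift_of_le_one (A := P.ring) h
  exact a.2

lemma residue_eq_zero_iff (f : P.ring) :
    IsLocalRing.residue P.ring f = 0 ↔ P.valuation (f : F) < 1 := by
  rw [IsLocalRing.residue_eq_zero_iff]
  exact ((IsDiscreteValuationRing.maximalIdeal P.ring).valuation_lt_one_iff_mem (K := F) f).symm

lemma vanishesAt_iff_valuation_lt {f : F} : P.VanishesAt f ↔ P.valuation f < 1 := by
  refine ⟨fun ⟨h, h0⟩ => (P.residue_eq_zero_iff _).1 h0, fun h => ?_⟩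
  exact ⟨P.mem_ring_iff.2 h.le, (P.residue_eq_zero_iff ⟨f, _⟩).2 h⟩

lemma exists_uniformizer : ∃ x : F, P.valuation x = exp (-1) :=
  (IsDiscreteValuationRing.maximalIdeal P.ring).valuation_exists_uniformizer F

lemma valuation_algebraMap {a : k} (ha : a ≠ 0) : P.valuation (algebraMap k F a) = 1 := by
  refine le_antisymm (P.valuation_le_one (P.algebraMap_mem a)) ?_
  have h := P.valuation_le_one (P.algebraMap_mem a⁻¹)
  rwa [map_inv₀, map_inv₀, inv_le_one₀] at h
  simpa [zero_lt_iff] using ha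

lemma valuation_smul_le (a : k) (f : F) : P.valuation (a • f) ≤ P.valuation f := by
  rw [Algebra.smul_def, map_mul]
  exact mul_le_of_le_one_left' (P.valuation_le_one (P.algebraMap_mem a))

lemma valuation_le_one_of_isAlgebraic {f : F} (hf : IsAlgebraic k f) : P.valuation f ≤ 1 :=
  P.mem_ring_iff.1 (mem_valuationSubring_of_isAlgebraic P.ring P.algebraMap_mem hf)

lemma valuation_eq_one_of_isAlgebraic {f : F} (hf : IsAlgebraic k f) (h0 : f ≠ 0) :
    P.valuation f = 1 := by
  refine le_antisymm (P.valuation_le_one_of_isAlgebraic hf) ?_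
  have h := P.valuation_le_one_of_isAlgebraic hf.inv
  rwa [map_inv₀, inv_le_one₀] at h
  simpa [zero_lt_iff] using h0

/-- Both sides are normalized discrete valuations with valuation ring `τ(O_P)`, so
`Valuation.ext_of_le_one_iff` identifies them. -/
lemma valuation_conj (τ : F ≃ₐ[k] F) (f : F) :
    (P.conj τ).valuation f = P.valuation (τ.symm f) := by
  have : (P.conj τ).valuation = P.valuation.comap (τ.symm : F →+* F) := by
    refine Valuation.ext_of_le_one_iff (fun x => ?_) (P.conj τ).exists_uniformizer ?_
    · rw [← mem_ring_iff, mem_conj_iff, mem_ring_iff]; rfl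
    · obtain ⟨x, hx⟩ := P.exists_uniformizer
      exact ⟨τ x, by simpa using hx⟩
  rw [this]; rfl

lemma conj_conj (τ ρ : F ≃ₐ[k] F) : (P.conj τ).conj ρ = P.conj (ρ * τ) := by
  apply Place.ext; ext f; rfl

lemma conj_one : P.conj (1 : F ≃ₐ[k] F) = P := by
  apply Place.ext; ext f; rfl

/-- Conjugation identifies the valuation rings. -/
noncomputable def conjRingEquiv (τ : F ≃ₐ[k] F) : P.ring ≃+* (P.conj τ).ring where
  toFun x := ⟨τ x, by simp [mem_conj_iff]⟩
  invFun y := ⟨τ.symm y, y.2⟩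
  left_inv x := by simp
  right_inv y := by simp
  map_mul' x y := by ext; simp
  map_add' x y := by ext; simp

lemma residue_smul (c : k) (x : P.ring) :
    IsLocalRing.residue P.ring (c • x) = c • IsLocalRing.residue P.ring x := rfl

lemma coe_smul (c : k) (x : P.ring) : ((c • x : P.ring) : F) = c • (x : F) := by
  rw [Algebra.smul_def, Algebra.smul_def]; rfl

lemma degree_conj (τ : F ≃ₐ[k] F) : (P.conj τ).degree = P.degree := by
  let e := IsLocalRing.ResidueField.mapEquiv (P.conjRingEquiv τ)
  have he (x : P.ring) : e (IsLocalRing.residue _ x) =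
    IsLocalRing.residue _ (P.conjRingEquiv τ x) := rfl
  refine (LinearEquiv.finrank_eq (R := k)
    ({ e with map_smul' := fun c y => ?_ } : _ ≃ₗ[k] _)).symm
  obtain ⟨x, rfl⟩ := IsLocalRing.residue_surjective y
  change e (c • _) = c • e _
  rw [← residue_smul, he, he, ← residue_smul]
  congr 1
  ext
  rw [coe_smul]
  change τ ((c • x : P.ring) : F) = c • τ (x : F)
  rw [coe_smul, map_smul]

end Place
end AlgFunField

/-! ### Linear independence over `k(x)` and over the fixed field of `σ`. -/

namespace AlgFunField

section

variable {k F : Type*} [Field k] [Field F] [Algebra k F]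

open Polynomial in
open scoped IntermediateField.algebraAdjoinAdjoin in
/-- Elements that are linearly independent over `k` modulo `x M`, where `M` is stable under
multiplication by `x`, are linearly independent over `k(x)`. -/
lemma linearIndependent_adjoin_of_mod {x : F} (hx : Transcendental k x) (M : Submodule k F)
    (hxM : ∀ m ∈ M, x * m ∈ M) {ι : Type*} [Fintype ι] (y : ι → F) (hy : ∀ i, y i ∈ M)
    (h : ∀ c : ι → k, (∃ m ∈ M, ∑ i, c i • y i = x * m) → c = 0) :
    LinearIndependent (IntermediateField.adjoin k {x}) y := by
  have hx0 : x ≠ 0 := by rintro rfl; exact hx isAlgebraic_zero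
  have hM (p : k[X]) (m : F) (hm : m ∈ M) : aeval x p * m ∈ M := by
    induction p using Polynomial.induction_on' with
    | add p q hp hq => rw [map_add, add_mul]; exact add_mem hp hq
    | monomial n a =>
      rw [aeval_monomial, mul_assoc, ← Algebra.smul_def]
      refine M.smul_mem _ ?_
      induction n with
      | zero => simpa using hm
      | succ n ih => rw [pow_succ', mul_assoc]; exact hxM _ ih
  -- Descent: modulo `x M` only the constant coefficients survive, so they vanish. Dividing by `x`
  -- leaves a relation of the same kind.
  have step : ∀ N : ℕ, ∀ φ : ι → k[X], ∑ i, aeval x (φ i) * y i = 0 → ∀ i, X ^ N ∣ φ i := by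
    intro N
    induction N with
    | zero => simp
    | succ N ih =>
      intro φ hφ
      have hd (i : ι) : aeval x (φ i) = x * aeval x (divX (φ i)) +
          algebraMap k F ((φ i).coeff 0) := by
        conv_lhs => rw [← X_mul_divX_add (φ i), map_add, map_mul, aeval_X, aeval_C]
      simp_rw [hd, add_mul, Finset.sum_add_distrib, mul_assoc, ← Finset.mul_sum,
        ← Algebra.smul_def] at hφ
      have hc : (fun i => (φ i).coeff 0) = 0 := by
        refine h _ ⟨-∑ i, aeval x (divX (φ i)) * y i,
          neg_mem (sum_mem fun i _ => hM _ _ (hy i)), ?_⟩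
        rw [mul_neg, eq_neg_iff_add_eq_zero, add_comm]; exact hφ
      have hc' (i : ι) : (φ i).coeff 0 = 0 := congrFun hc i
      simp only [hc', zero_smul, Finset.sum_const_zero, add_zero, mul_eq_zero, hx0,
        false_or] at hφ
      intro i
      have := ih _ hφ i
      rw [← X_mul_divX_add (φ i), hc' i, C_0, add_zero, pow_succ']
      exact mul_dvd_mul_left _ this
  rw [← LinearIndependent.iff_fractionRing (R := Algebra.adjoin k {x}),
    Fintype.linearIndependent_iff]
  intro g hg i
  have hrep (i : ι) : ∃ p : k[X], aeval x p = (g i : F) := by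
    exact (Algebra.adjoin_singleton_eq_range_aeval k x ▸ (g i).2 :
      (g i : F) ∈ (aeval x : k[X] →ₐ[k] F).range)
  choose φ hφ using hrep
  have h0 : ∑ i, aeval x (φ i) * y i = 0 := by
    rw [← hg]
    refine Finset.sum_congr rfl fun i _ => ?_
    rw [hφ, Algebra.smul_def]; rfl
  have : φ i = 0 := by
    by_contra hne
    have hd := step ((φ i).natDegree + 1) φ h0 i
    have := natDegree_le_of_dvd hd hne
    simp at this
  ext
  rw [← hφ, this]; simp

lemma card_le_finrank_adjoin_of_mod {x : F} (hx : Transcendental k x)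
    [FiniteDimensional (IntermediateField.adjoin k {x}) F] (M : Submodule k F)
    (hxM : ∀ m ∈ M, x * m ∈ M) {ι : Type*} [Fintype ι] (y : ι → F) (hy : ∀ i, y i ∈ M)
    (h : ∀ c : ι → k, (∃ m ∈ M, ∑ i, c i • y i = x * m) → c = 0) :
    Fintype.card ι ≤ Module.finrank (IntermediateField.adjoin k {x}) F :=
  (linearIndependent_adjoin_of_mod hx M hxM y hy h).fintype_card_le_finrank

/-- A relation between the first `#S` conjugates of a family that is linearly independent over
the fixed field of `σ` is trivial. -/
lemma eq_zero_of_forall_sum_mul_pow_eq_zero (σ : F ≃ₐ[k] F) {ι : Type*} [DecidableEq ι]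
    (f : ι → F)
    (hf : LinearIndependent (IntermediateField.fixedField (Subgroup.zpowers σ)) f)
    (S : Finset ι) (a : ι → F)
    (h : ∀ j < S.card, ∑ i ∈ S, a i * (σ ^ j) (f i) = 0) : ∀ i ∈ S, a i = 0 := by
  induction hn : S.card generalizing S a with
  | zero => simp [Finset.card_eq_zero.1 hn]
  | succ n ih =>
    by_contra! hne
    obtain ⟨i₀, hi₀, ha₀⟩ := hne
    -- Artin's argument: with the coefficient at `i₀` equal to `1`, apply `σ⁻¹` to relation `j + 1`
    -- and subtract relation `j`. The term at `i₀` cancels, so by induction every `b i` is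
    -- `σ`-fixed, and relation `0` contradicts `hf`.
    set b : ι → F := fun i => a i / a i₀ with hb
    have hbrel : ∀ j < S.card, ∑ i ∈ S, b i * (σ ^ j) (f i) = 0 := by
      intro j hj
      have := h j hj
      simp only [hb, div_mul_eq_mul_div, ← Finset.sum_div, this, zero_div]
    have hb1 : b i₀ = 1 := div_self ha₀
    have hcard : (S.erase i₀).card = n := by rw [Finset.card_erase_of_mem hi₀, hn]; rfl
    have hfix := ih (S.erase i₀) (fun i => σ.symm (b i) - b i) (by
      intro j hj
      rw [hcard] at hj
      have h1 := hbrel (j + 1) (by omega)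
      have h2 := hbrel j (by omega)
      have h3 : ∑ i ∈ S, σ.symm (b i) * (σ ^ j) (f i) = 0 := by
        have := congrArg σ.symm h1
        simp only [map_sum, map_mul, map_zero] at this
        rw [← this]
        refine Finset.sum_congr rfl fun i _ => ?_
        rw [pow_succ', AlgEquiv.mul_apply, AlgEquiv.symm_apply_apply]
      have h4 : ∑ i ∈ S, (σ.symm (b i) - b i) * (σ ^ j) (f i) = 0 := by
        simp only [sub_mul, Finset.sum_sub_distrib, h2, h3, sub_zero]
      rwa [← Finset.add_sum_erase _ _ hi₀, hb1, map_one, sub_self, zero_mul, zero_add] at h4)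
      hcard
    have hσb (i : ι) (hi : i ∈ S) : σ (b i) = b i := by
      by_cases hii : i = i₀
      · rw [hii, hb1, map_one]
      · have := hfix i (Finset.mem_erase.2 ⟨hii, hi⟩)
        rw [sub_eq_zero, AlgEquiv.symm_apply_eq] at this
        exact this.symm
    have hmem (i : ι) (hi : i ∈ S) :
        b i ∈ IntermediateField.fixedField (Subgroup.zpowers σ) := by
      rw [IntermediateField.mem_fixedField_iff]
      intro g hg
      have hle : Subgroup.zpowers σ ≤ MulAction.stabilizer (F ≃ₐ[k] F) (b i) := by
        rw [Subgroup.zpowers_le]; exact hσb i hi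
      exact hle hg
    have h0 := hbrel 0 (by omega)
    rw [linearIndependent_iff'] at hf
    have := hf S (fun i => if hi : i ∈ S then ⟨b i, hmem i hi⟩ else 0) (by
      rw [← h0]
      refine Finset.sum_congr rfl fun i hi => ?_
      simp [hi, Algebra.smul_def]) i₀ hi₀
    simp only [hi₀, dite_true] at this
    have := congrArg Subtype.val this
    simp [hb1] at this

/-- The Casorati determinant of a family that is linearly independent over the fixed field of `σ`
does not vanish. -/
lemma det_pow_apply_ne_zero (σ : F ≃ₐ[k] F) {s : ℕ} (f : Fin s → F)
    (hf : LinearIndependent (IntermediateField.fixedField (Subgroup.zpowers σ)) f) :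
    (Matrix.of fun i j : Fin s => (σ ^ (j : ℕ)) (f i)).det ≠ 0 := by
  intro hdet
  obtain ⟨a, ha, ha0⟩ := Matrix.exists_vecMul_eq_zero_iff.2 hdet
  refine ha (funext fun i => ?_)
  refine eq_zero_of_forall_sum_mul_pow_eq_zero σ f hf Finset.univ a (fun j hj => ?_) i
    (Finset.mem_univ _)
  simpa [Matrix.vecMul, dotProduct] using congrFun ha0 ⟨j, by simpa using hj⟩

end
end AlgFunField

/-! ### Discreteness of valuation rings and existence of poles. -/

namespace AlgFunField

open scoped WithZero
open WithZero

variable {k F : Type*} [Field k] [Field F] [Algebra k F]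

open scoped IntermediateField.algebraAdjoinAdjoin in
-- The transcendence degree is at most one, so `x` is a transcendence basis and `F` is algebraic
-- over `k(x)`. Being also essentially of finite type, it is finite.
lemma IsFunctionField.finiteDimensional_adjoin (hF : IsFunctionField k F) {x : F}
    (hx : Transcendental k x) : FiniteDimensional (IntermediateField.adjoin k {x}) F := by
  obtain ⟨z, -, hfin⟩ := hF
  have hess : Algebra.EssFiniteType k (IntermediateField.adjoin k {z}) :=
    IntermediateField.essFiniteType_iff.2 ⟨{z}, by simp⟩
  have : Algebra.EssFiniteType k F :=
    Algebra.EssFiniteType.comp k (IntermediateField.adjoin k {z}) F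
  have : Algebra.EssFiniteType (IntermediateField.adjoin k {x}) F :=
    Algebra.EssFiniteType.of_comp k _ F
  have : Algebra.IsAlgebraic (Algebra.adjoin k {z}) F :=
    Algebra.IsAlgebraic.trans (Algebra.adjoin k {z}) (IntermediateField.adjoin k {z}) F
  have htr : Algebra.trdeg k F ≤ 1 := by
    simpa using Algebra.IsAlgebraic.trdeg_le_cardinalMk k ({z} : Set F)
  have hind : AlgebraicIndependent k (fun _ : Unit => x) :=
    algebraicIndependent_unique_type_iff.2 hx
  have hb := hind.isTranscendenceBasis_of_lift_trdeg_le_of_finite (by simpa using htr)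
  have : Algebra.IsAlgebraic (IntermediateField.adjoin k {x}) F := by
    have h := hb.isAlgebraic_field
    rwa [Set.range_const] at h
  exact Algebra.finite_of_essFiniteType_of_isAlgebraic

/-- Elements with distinct values above that of `z` are independent over `k` modulo `z O`, as a sum
of terms with distinct values takes the largest one. Hence there are at most `[F : k(z)]` such
values. -/
lemma IsFunctionField.finite_valuation_gt
    (hF : IsFunctionField k F) (O : ValuationSubring F) (hO : ∀ a : k, algebraMap k F a ∈ O)
    {z : F} (hz : Transcendental k z) (hzO : z ∈ O) :
    {γ | γ ≤ 1 ∧ O.valuation z < γ}.Finite := by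
  have := hF.finiteDimensional_adjoin hz
  by_contra hinf
  obtain ⟨T, hT, hcard⟩ := Set.Infinite.exists_subset_card_eq hinf
    (Module.finrank (IntermediateField.adjoin k {z}) F + 1)
  choose y hy using fun γ : T => O.valuation_surjective (γ : O.ValueGroup)
  have hunit (c : k) (hc : c ≠ 0) : O.valuation (algebraMap k F c) = 1 := by
    refine le_antisymm ((O.valuation_le_one_iff _).2 (hO c)) ?_
    have h := (O.valuation_le_one_iff _).2 (hO c⁻¹)
    rwa [map_inv₀, map_inv₀, inv_le_one₀] at h
    simpa [zero_lt_iff] using hc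
  let M : Submodule k F :=
    { O.toSubring.toAddSubgroup.toAddSubmonoid with
      smul_mem' := fun c f hf => by
        rw [Algebra.smul_def]; exact O.mul_mem _ _ (hO c) hf }
  have hM (f : F) : f ∈ M ↔ f ∈ O := Iff.rfl
  have hle := card_le_finrank_adjoin_of_mod hz M (fun m hm => O.mul_mem _ _ hzO hm) y
    (fun γ => by
      rw [hM, ← O.valuation_le_one_iff, hy]; exact (hT γ.2).1) (by
    rintro c ⟨m, hm, hsum⟩
    by_contra hc
    classical
    obtain ⟨γ₀, hγ₀, hmax⟩ := (Finset.univ.filter fun γ : T => c γ ≠ 0).exists_max_image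
      (fun γ => (γ : O.ValueGroup)) (by
        obtain ⟨i, hi⟩ := Function.ne_iff.1 hc
        exact ⟨i, by simpa using hi⟩)
    simp only [Finset.mem_filter, Finset.mem_univ, true_and] at hγ₀ hmax
    have hval (γ : T) (h : c γ ≠ 0) : O.valuation (c γ • y γ) = γ := by
      rw [Algebra.smul_def, map_mul, hunit _ h, one_mul, hy]
    have h1 : O.valuation (∑ γ, c γ • y γ) = γ₀ := by
      rw [← hval γ₀ hγ₀]
      refine Valuation.map_sum_eq_of_lt _ (Finset.mem_univ _) ?_
      intro γ hγ
      simp only [Finset.mem_sdiff, Finset.mem_univ, Finset.mem_singleton, true_and] at hγ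
      rw [hval _ hγ₀]
      by_cases h : c γ = 0
      · rw [h, zero_smul, map_zero]; exact zero_le.trans_lt (hT γ₀.2).2
      · rw [hval _ h]
        exact lt_of_le_of_ne (hmax _ h) fun e => hγ (Subtype.ext e)
    have h2 : O.valuation (∑ γ, c γ • y γ) ≤ O.valuation z := by
      rw [hsum, map_mul]
      exact mul_le_of_le_one_right' ((O.valuation_le_one_iff _).2 hm)
    exact (h2.trans_lt (hT γ₀.2).2).ne h1)
  rw [Fintype.card_coe, hcard] at hle
  omega

/-- A proper valuation ring of a function field that contains the constants is discrete. -/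
lemma IsFunctionField.isDiscreteValuationRing
    (hF : IsFunctionField k F) (O : ValuationSubring F) (hO : ∀ a : k, algebraMap k F a ∈ O)
    {y : F} (hy0 : y ≠ 0) (hy : O.valuation y < 1) : IsDiscreteValuationRing O := by
  have htrans {z : F} (hz0 : z ≠ 0) (hz : O.valuation z < 1) : Transcendental k z := by
    intro halg
    have h := (O.valuation_le_one_iff _).2 (mem_valuationSubring_of_isAlgebraic O hO halg.inv)
    rw [map_inv₀, inv_le_one₀ (by simpa [zero_lt_iff] using hz0)] at h
    exact hz.not_ge h
  have hpid : IsPrincipalIdealRing O := by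
    refine ⟨fun I => ?_⟩
    rcases eq_or_ne I ⊥ with rfl | hI
    · infer_instance
    obtain ⟨z, hzI, hz0⟩ := Submodule.exists_mem_ne_zero_of_ne_bot hI
    have hz0' : (z : F) ≠ 0 := by simpa using hz0
    -- Finitely many values of elements of `I` are at least that of `z`, so a largest value is
    -- attained. An element attaining it generates `I`, since divisibility in `O` is comparison of
    -- values.
    have hfin : ((fun a : O => O.valuation (a : F)) ''
        {a | a ∈ I ∧ O.valuation (z : F) ≤ O.valuation (a : F)}).Finite := by
      rcases (O.valuation_le_one z).lt_or_eq with h | h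
      · refine ((hF.finite_valuation_gt O hO (htrans hz0' h) z.2).insert
          (O.valuation (z : F))).subset ?_
        rintro _ ⟨a, ⟨-, ha⟩, rfl⟩
        rcases ha.lt_or_eq with h' | h'
        · exact Or.inr ⟨O.valuation_le_one a, h'⟩
        · exact Or.inl h'.symm
      · refine (Set.finite_singleton 1).subset ?_
        rintro _ ⟨a, ⟨-, ha⟩, rfl⟩
        exact le_antisymm (O.valuation_le_one a) (h ▸ ha)
    obtain ⟨_, ⟨g, ⟨hgI, hzg⟩, rfl⟩, hmax⟩ := hfin.exists_maximalFor id _ ⟨_, z, ⟨hzI, le_rfl⟩, rfl⟩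
    refine ⟨g, le_antisymm (fun a ha => ?_) (by simpa [Ideal.span_le] using hgI)⟩
    have hle : O.valuation (a : F) ≤ O.valuation (g : F) := by
      rcases le_total (O.valuation (a : F)) (O.valuation (g : F)) with h | h
      · exact h
      · exact hmax ⟨a, ⟨ha, hzg.trans h⟩, rfl⟩ h
    rw [Ideal.submodule_span_eq, Ideal.mem_span_singleton]
    exact (O.valuation_le_iff a g).1 hle |>.imp fun c hc => by ext; rw [mul_comm]; exact hc.symm
  refine { hpid with not_a_field' := fun h => ?_ }
  have hyO : y ∈ O := (O.valuation_le_one_iff _).1 hy.le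
  have : (⟨y, hyO⟩ : O) ∈ IsLocalRing.maximalIdeal O := (O.valuation_lt_one_iff ⟨y, hyO⟩).2 hy
  rw [h] at this
  exact hy0 (congrArg Subtype.val this)

open Polynomial in
/-- Every transcendental element of a function field has a pole. -/
lemma IsFunctionField.exists_place_one_lt_valuation (hF : IsFunctionField k F) {x : F}
    (hx : Transcendental k x) : ∃ P : Place k F, 1 < P.valuation x := by
  have hx0 : x ≠ 0 := by rintro rfl; exact hx isAlgebraic_zero
  have hxi : Transcendental k x⁻¹ := fun h => hx (by simpa using h.inv)
  let A := Algebra.adjoin k {x⁻¹}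
  let y : A := ⟨x⁻¹, Algebra.self_mem_adjoin_singleton k _⟩
  -- As `x⁻¹` is not a unit in `k[x⁻¹]`, some valuation ring of `F` containing `k[x⁻¹]` has it as a
  -- nonunit.
  have hI : (Ideal.span {y} : Ideal A.toSubring) ≠ ⊤ := by
    rw [Ne, Ideal.span_singleton_eq_top]
    intro hu
    obtain ⟨b, hb⟩ := hu.exists_right_inv
    obtain ⟨p, hp⟩ : (b : F) ∈ (aeval x⁻¹ : k[X] →ₐ[k] F).range :=
      Algebra.adjoin_singleton_eq_range_aeval k x⁻¹ ▸ b.2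
    have hb' : x⁻¹ * (b : F) = 1 := congrArg Subtype.val hb
    have h1 : aeval x⁻¹ (X * p - 1) = 0 := by
      rw [map_sub, map_mul, aeval_X, map_one]
      exact sub_eq_zero.2 (hp ▸ hb')
    have h2 := (transcendental_iff.1 hxi) _ h1
    have h3 := congrArg (eval 0) h2
    simp at h3
  obtain ⟨O, hAO, hO⟩ := Ideal.image_subset_nonunits_valuationSubring _ hI
  have hk (a : k) : algebraMap k F a ∈ O := hAO (A.algebraMap_mem a)
  have hy : O.valuation x⁻¹ < 1 :=
    O.mem_nonunits_iff.1 (hO ⟨y, Ideal.mem_span_singleton_self _, rfl⟩)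
  let P : Place k F := ⟨O, hF.isDiscreteValuationRing O hk (inv_ne_zero hx0) hy, hk⟩
  refine ⟨P, not_le.1 fun h => ?_⟩
  rw [← P.mem_ring_iff] at h
  have hxO : O.valuation x ≤ 1 := (O.valuation_le_one_iff _).2 h
  rw [map_inv₀] at hy
  have h0 : 0 < O.valuation x := by simpa [zero_lt_iff] using hx0
  rw [inv_lt_one₀ h0] at hy
  exact absurd hxO hy.not_ge

end AlgFunField

/-! ### Weak approximation and the number of zeros. -/

namespace AlgFunField

open scoped WithZero
open WithZero Filter

lemma eventually_lt_pow {a : ℤᵐ⁰} (ha : 1 < a) (c : ℤᵐ⁰) : ∀ᶠ n : ℕ in atTop, c < a ^ n := by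
  rcases eq_or_ne c 0 with rfl | hc
  · exact Eventually.of_forall fun n => pow_pos (zero_lt_one.trans ha) n
  have ha0 : a ≠ 0 := (zero_lt_one.trans ha).ne'
  have h1 : 1 ≤ log a := by
    rw [← exp_zero, ← lt_log_iff_exp_lt ha0] at ha; omega
  filter_upwards [eventually_gt_atTop (log c).natAbs] with n hn
  rw [← exp_log hc, ← exp_log ha0, ← exp_nsmul, exp_lt_exp, nsmul_eq_mul]
  have : log c ≤ (log c).natAbs := Int.le_natAbs
  have : ((log c).natAbs : ℤ) < n := by exact_mod_cast hn
  nlinarith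

lemma exp_natCast_le_pow {a : ℤᵐ⁰} (ha : 1 < a) (n : ℕ) : exp (n : ℤ) ≤ a ^ n := by
  have ha0 : a ≠ 0 := (zero_lt_one.trans ha).ne'
  have h1 : 1 ≤ log a := by
    rw [← exp_zero, ← lt_log_iff_exp_lt ha0] at ha; omega
  rw [← exp_log ha0, ← exp_nsmul, exp_le_exp, nsmul_eq_mul]
  nlinarith [Int.natCast_nonneg n]

lemma pow_le_exp_neg {a : ℤᵐ⁰} (ha : a < 1) (n : ℕ) : a ^ n ≤ exp (-(n : ℤ)) := by
  have := pow_le_pow_left₀ zero_le (lt_one_iff_le_exp_neg_one.1 ha) n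
  rwa [← exp_nsmul, smul_neg, nsmul_one] at this

namespace Place

variable {k F : Type*} [Field k] [Field F] [Algebra k F]

/-- Discrete valuation rings are maximal proper subrings. If `O_P ⊆ O_Q` and `f ∈ O_Q` is not in
`O_P`, then for a uniformizer `π` of `Q` some `π⁻¹ / f ^ n` lies in `O_P`, hence in `O_Q`, and so
would `π⁻¹`. -/
lemma exists_valuation_le_one_one_lt {P Q : Place k F} (h : P ≠ Q) :
    ∃ a, P.valuation a ≤ 1 ∧ 1 < Q.valuation a := by
  by_contra! hle
  refine h (Place.ext (le_antisymm (fun a ha => Q.mem_ring_iff.2 (hle a (P.mem_ring_iff.1 ha)))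
    fun f hf => ?_))
  by_contra hfP
  rw [P.mem_ring_iff, not_le] at hfP
  rw [Q.mem_ring_iff] at hf
  obtain ⟨π, hπ⟩ := Q.exists_uniformizer
  obtain ⟨n, hn⟩ := (eventually_lt_pow hfP (P.valuation π⁻¹)).exists
  have hf0 : 0 < P.valuation f ^ n := pow_pos (zero_lt_one.trans hfP) n
  have h1 := hle (π⁻¹ / f ^ n) (by
    rw [map_div₀, map_pow, div_le_one₀ hf0]; exact hn.le)
  have hfQ : 0 < Q.valuation f ^ n := by
    rw [← map_pow] at hf0 ⊢
    rw [zero_lt_iff, Valuation.ne_zero_iff] at hf0 ⊢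
    exact hf0
  rw [map_div₀, map_pow, div_le_one₀ hfQ, map_inv₀, hπ, ← exp_neg, neg_neg] at h1
  have h2 := h1.trans (pow_le_one₀ zero_le hf)
  rw [← exp_zero, exp_le_exp] at h2
  omega

lemma exists_valuation_lt_one_one_lt {P Q : Place k F} (h : P ≠ Q) :
    ∃ a, P.valuation a < 1 ∧ 1 < Q.valuation a := by
  obtain ⟨a, haP, haQ⟩ := exists_valuation_le_one_one_lt h
  obtain ⟨b, hbQ, hbP⟩ := exists_valuation_le_one_one_lt h.symm
  have hb : b ≠ 0 := by rintro rfl; simp at hbP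
  refine ⟨a / b, ?_, ?_⟩
  · rw [map_div₀, div_lt_one₀ (zero_lt_one.trans hbP)]; exact haP.trans_lt hbP
  · rw [map_div₀, one_lt_div₀ (by simpa [zero_lt_iff] using hb)]; exact hbQ.trans_lt haQ

lemma exists_valuation_lt_one_forall_one_lt (P : Place k F) (S : Finset (Place k F))
    (hP : P ∉ S) : ∃ a, P.valuation a < 1 ∧ ∀ Q ∈ S, 1 < Q.valuation a := by
  classical
  induction S using Finset.induction_on with
  | empty => exact ⟨0, by simp, by simp⟩
  | insert R S hR ih =>
    rw [Finset.mem_insert, not_or] at hP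
    obtain ⟨u, huP, huS⟩ := ih hP.2
    rcases lt_or_ge 1 (R.valuation u) with hu | hu
    · exact ⟨u, huP, by simpa using ⟨hu, huS⟩⟩
    obtain ⟨w, hwP, hwR⟩ := exists_valuation_lt_one_one_lt hP.1
    have hev : ∀ᶠ n : ℕ in atTop, ∀ Q ∈ S, Q.valuation w < Q.valuation u ^ n :=
      (eventually_all_finset S).2 fun Q hQ => eventually_lt_pow (huS Q hQ) _
    obtain ⟨n, hn, hn0⟩ := (hev.and (eventually_gt_atTop 0)).exists
    -- On `S` the power `u ^ n` dominates `w`; at `R`, where `u` is regular, `w` dominates.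
    refine ⟨w + u ^ n, Valuation.map_add_lt _ hwP ?_, fun Q hQ => ?_⟩
    · rw [map_pow]; exact pow_lt_one₀ zero_le huP hn0.ne'
    · rcases Finset.mem_insert.1 hQ with rfl | hQ
      · rw [Valuation.map_add_eq_of_lt_left]
        · exact hwR
        · rw [map_pow]; exact (pow_le_one₀ zero_le hu).trans_lt hwR
      · rw [Valuation.map_add_eq_of_lt_right]
        · rw [map_pow]; exact one_lt_pow₀ (huS Q hQ) hn0.ne'
        · rw [map_pow]; exact hn Q hQ

/-- Weak approximation: approximate `g` at `P` and `0` at the places of `S`. -/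
lemma exists_approx (P : Place k F) (S : Finset (Place k F)) (hP : P ∉ S) (g : F) (N : ℕ) :
    ∃ y, P.valuation (y - g) ≤ exp (-(N : ℤ)) ∧ ∀ Q ∈ S, Q.valuation y ≤ exp (-(N : ℤ)) := by
  classical
  obtain ⟨u, huP, huS⟩ := P.exists_valuation_lt_one_forall_one_lt S hP
  have hev : ∀ᶠ n : ℕ in atTop, ∀ Q ∈ insert P S,
      Q.valuation g * exp (-(n : ℤ)) ≤ exp (-(N : ℤ)) := by
    refine (eventually_all_finset _).2 fun Q _ => ?_
    filter_upwards [eventually_lt_pow (a := exp 1) (by rw [← exp_zero, exp_lt_exp]; omega)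
      (Q.valuation g * exp (N : ℤ))] with n hn
    have h := mul_le_mul_left hn.le (exp (-(n : ℤ)) * exp (-(N : ℤ)))
    rw [← exp_nsmul, nsmul_one] at h
    calc Q.valuation g * exp (-(n : ℤ))
        = Q.valuation g * exp (N : ℤ) * (exp (-(n : ℤ)) * exp (-(N : ℤ))) := by
          rw [mul_assoc, ← exp_add, ← exp_add]; congr 2; ring
      _ ≤ _ := h
      _ = _ := by rw [← exp_add, ← exp_add]; congr 1; ring
  obtain ⟨n, hn, hn0⟩ := (hev.and (eventually_gt_atTop 0)).exists
  -- The factor `1 / (1 + u ^ n)` tends to `1` at `P`, where `u` is small, and to `0` on `S`, where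
  -- `u` is large.
  refine ⟨g / (1 + u ^ n), ?_, fun Q hQ => ?_⟩
  · have hun : P.valuation (u ^ n) < 1 := by
      rw [map_pow]; exact pow_lt_one₀ zero_le huP hn0.ne'
    have h1 : P.valuation (1 + u ^ n) = 1 := Valuation.map_one_add_of_lt _ hun
    have h0 : 1 + u ^ n ≠ 0 := by
      intro h; rw [h, map_zero] at h1; exact zero_ne_one h1
    have e : g / (1 + u ^ n) - g = -(g * u ^ n / (1 + u ^ n)) := by field_simp; ring
    rw [e, Valuation.map_neg, map_div₀, h1, div_one, map_mul, map_pow]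
    exact (mul_le_mul_right (pow_le_exp_neg huP n) _).trans (hn P (Finset.mem_insert_self _ _))
  · have hun : 1 < Q.valuation (u ^ n) := by
      rw [map_pow]; exact one_lt_pow₀ (huS Q hQ) hn0.ne'
    have h1 : Q.valuation (1 + u ^ n) = Q.valuation (u ^ n) :=
      Valuation.map_add_eq_of_lt_right _ (by rwa [map_one])
    rw [map_div₀, h1, map_pow, div_eq_mul_inv]
    refine le_trans (mul_le_mul_right ?_ _) (hn Q (Finset.mem_insert_of_mem hQ))
    rw [exp_neg]
    exact inv_anti₀ (exp_pos) (exp_natCast_le_pow (huS Q hQ) n)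

/-- The elements `π ^ a * b j`, for `a < N` and lifts `b j` of linearly independent residue classes,
are linearly independent modulo `P ^ N`. -/
lemma eq_zero_of_valuation_sum_le (P : Place k F) {π : F} (hπ : P.valuation π = exp (-1))
    {d : ℕ} (b : Fin d → P.ring)
    (hb : LinearIndependent k fun j => IsLocalRing.residue P.ring (b j)) (N : ℕ)
    (c : ℕ → Fin d → k)
    (h : P.valuation (∑ a ∈ Finset.range N, ∑ j, c a j • (π ^ a * (b j : F))) ≤
      exp (-(N : ℤ))) : ∀ a < N, ∀ j, c a j = 0 := by
  induction N generalizing c with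
  | zero => simp
  | succ N ih =>
    have hπ0 : π ≠ 0 := by rintro rfl; exact absurd hπ.symm (by simp)
    -- Only the layer `a = 0` is visible in the residue field. Once its coefficients vanish, divide
    -- by `π`.
    set B : P.ring := ∑ j, c 0 j • b j with hB
    set R : F := ∑ a ∈ Finset.range N, ∑ j, c (a + 1) j • (π ^ a * (b j : F)) with hR
    have hBF : (B : F) = ∑ j, c 0 j • (b j : F) := by
      rw [hB, AddSubmonoidClass.coe_finsetSum]
      exact Finset.sum_congr rfl fun j _ => P.coe_smul _ _
    have hsum : ∑ a ∈ Finset.range (N + 1), ∑ j, c a j • (π ^ a * (b j : F)) = B + π * R := by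
      rw [Finset.sum_range_succ', add_comm, hBF, hR]
      congr 1
      · simp
      · simp_rw [Finset.mul_sum, mul_smul_comm, pow_succ', mul_assoc]
    have hR1 : P.valuation R ≤ 1 := by
      refine Valuation.map_sum_le _ fun a _ => Valuation.map_sum_le _ fun j _ =>
        (P.valuation_smul_le _ _).trans ?_
      rw [map_mul, map_pow]
      refine mul_le_one' (pow_le_one₀ zero_le ?_) (P.valuation_le_one (b j).2)
      rw [hπ, ← exp_zero, exp_le_exp]; omega
    rw [hsum] at h
    have hπ1 : P.valuation (π * R) ≤ exp (-1) := by
      rw [map_mul, hπ]; exact mul_le_of_le_one_right' hR1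
    have hBlt : P.valuation (B : F) < 1 := by
      rw [lt_one_iff_le_exp_neg_one]
      have := Valuation.map_sub_le _ (h.trans (exp_le_exp.2 (by push_cast; omega))) hπ1
      rwa [add_sub_cancel_right] at this
    have hc0 : ∀ j, c 0 j = 0 := by
      rw [← P.residue_eq_zero_iff, hB, map_sum] at hBlt
      exact Fintype.linearIndependent_iff.1 hb _ hBlt
    have hB0 : (B : F) = 0 := by rw [hBF]; simp [hc0]
    have hN : P.valuation R ≤ exp (-(N : ℤ)) := by
      rw [hB0, zero_add, map_mul, hπ] at h
      have h' := mul_le_mul_right h (exp 1)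
      rw [← mul_assoc, ← exp_add, ← exp_add] at h'
      simpa using h'
    intro a ha j
    rcases a with _ | a
    · exact hc0 j
    · exact ih (fun a => c (a + 1)) hN a (by omega) j

/-- The zeros of `x` on a finite set of places, counted with the dimensions `d P` of subspaces of
the residue fields, are at most `[F : k(x)]` in number. -/
lemma sum_mul_le_finrank {x : F} (hx : Transcendental k x)
    [FiniteDimensional (IntermediateField.adjoin k {x}) F] (S : Finset (Place k F))
    (m : Place k F → ℕ) (hm : ∀ P ∈ S, P.valuation x ≤ exp (-(m P : ℤ)))
    (d : Place k F → ℕ) (b : ∀ P : Place k F, Fin (d P) → IsLocalRing.ResidueField P.ring)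
    (hb : ∀ P ∈ S, LinearIndependent k (b P)) :
    ∑ P ∈ S, m P * d P ≤ Module.finrank (IntermediateField.adjoin k {x}) F := by
  classical
  choose π hπ using fun P : Place k F => P.exists_uniformizer
  choose g hg using fun (P : Place k F) (j : Fin (d P)) =>
    IsLocalRing.residue_surjective (R := P.ring) (b P j)
  have hg1 (P : Place k F) (a : ℕ) (j : Fin (d P)) :
      P.valuation (π P ^ a * (g P j : F)) ≤ 1 := by
    rw [map_mul, map_pow]
    refine mul_le_one' (pow_le_one₀ zero_le ?_) (P.valuation_le_one (g P j).2)
    rw [hπ, ← exp_zero, exp_le_exp]; omega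
  -- Localize each `π ^ a * g j` at its own place, making it small elsewhere on `S`. The precision
  -- `S.sup m` suffices for every place at once.
  choose y hyP hyQ using fun (P : Place k F) (a : ℕ) (j : Fin (d P)) =>
    P.exists_approx (S.erase P) (by simp) (π P ^ a * (g P j : F)) (S.sup m)
  have hexp {P : Place k F} (hP : P ∈ S) : exp (-(S.sup m : ℕ) : ℤ) ≤ exp (-(m P : ℤ)) := by
    have : m P ≤ S.sup m := Finset.le_sup hP
    rw [exp_le_exp]; omega
  have hexp1 (n : ℕ) : exp (-(n : ℤ)) ≤ 1 := by rw [← exp_zero, exp_le_exp]; omega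
  let M : Submodule k F :=
    { carrier := {f | ∀ P ∈ S, P.valuation f ≤ 1}
      zero_mem' := fun P _ => by simp
      add_mem' := fun hf hg P hP => Valuation.map_add_le _ (hf P hP) (hg P hP)
      smul_mem' := fun c f hf P hP => (P.valuation_smul_le _ _).trans (hf P hP) }
  let ι := Σ P : S, Fin (m P) × Fin (d P)
  have hcard : Fintype.card ι = ∑ P ∈ S, m P * d P := by
    simp only [ι, Fintype.card_sigma, Fintype.card_prod, Fintype.card_fin]
    exact Finset.sum_coe_sort S fun P => m P * d P
  rw [← hcard]
  refine card_le_finrank_adjoin_of_mod hx M (fun f hf P hP => ?_)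
    (fun i : ι => y i.1 i.2.1 i.2.2) (fun i P hP => ?_) fun c hc => ?_
  · rw [map_mul]; exact mul_le_one' ((hm P hP).trans (hexp1 _)) (hf P hP)
  · by_cases h : P = i.1
    · subst h
      have := Valuation.map_add_le _ ((hyP i.1 i.2.1 i.2.2).trans (hexp1 _))
        (hg1 i.1 i.2.1 i.2.2)
      rwa [sub_add_cancel] at this
    · exact (hyQ i.1 i.2.1 i.2.2 P (Finset.mem_erase.2 ⟨h, hP⟩)).trans (hexp1 _)
  · obtain ⟨f, hf, hsum⟩ := hc
    funext ⟨P, a, j⟩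
    -- Elements of `x M` have order at least `m P` at `P`. Discarding the terms of other places and
    -- the approximation errors leaves a combination of the `π ^ a * g j` of that order.
    have hval : (P : Place k F).valuation (∑ i : ι, c i • y i.1 i.2.1 i.2.2) ≤
        exp (-(m P : ℤ)) := by
      rw [hsum, map_mul]
      exact (mul_le_of_le_one_right' (hf P P.2)).trans (hm P P.2)
    rw [Fintype.sum_sigma, ← Finset.add_sum_erase _ _ (Finset.mem_univ P)] at hval
    have hrest : (P : Place k F).valuation (∑ Q ∈ Finset.univ.erase P,
        ∑ q : Fin (m Q) × Fin (d Q), c ⟨Q, q⟩ • y Q q.1 q.2) ≤ exp (-(m P : ℤ)) := by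
      refine Valuation.map_sum_le _ fun Q hQ => Valuation.map_sum_le _ fun q _ =>
        (Place.valuation_smul_le _ _ _).trans ((hyQ Q q.1 q.2 P ?_).trans (hexp P.2))
      exact Finset.mem_erase.2 ⟨fun h => (Finset.mem_erase.1 hQ).1 (Subtype.ext h.symm), P.2⟩
    have h1 := Valuation.map_sub_le _ hval hrest
    rw [add_sub_cancel_right] at h1
    have h2 : (P : Place k F).valuation (∑ q : Fin (m P) × Fin (d P),
        c ⟨P, q⟩ • (y P q.1 q.2 - π P ^ (q.1 : ℕ) * (g P q.2 : F))) ≤ exp (-(m P : ℤ)) :=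
      Valuation.map_sum_le _ fun q _ =>
        (Place.valuation_smul_le _ _ _).trans ((hyP P q.1 q.2).trans (hexp P.2))
    have h3 := Valuation.map_sub_le _ h1 h2
    rw [← Finset.sum_sub_distrib] at h3
    simp_rw [← smul_sub, sub_sub_cancel] at h3
    rw [Fintype.sum_prod_type] at h3
    have h4 := (P : Place k F).eq_zero_of_valuation_sum_le (hπ P) (g P)
      (by simpa only [hg] using hb P P.2) (m P)
      (fun a j => if ha : a < m P then c ⟨P, ⟨a, ha⟩, j⟩ else 0) (by
        rw [Finset.sum_range]
        simpa using h3) a a.2 j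
    simpa using h4

end Place

variable {k F : Type*} [Field k] [Field F] [Algebra k F]

/-- Counting the zero of a uniformizer `x` at `P` alone bounds every independent family of residue
classes by `[F : k(x)]`. For this reason `Place.sum_mul_le_finrank` allows families that are not
bases. -/
lemma IsFunctionField.finite_residueField (hF : IsFunctionField k F) (P : Place k F) :
    Module.Finite k (IsLocalRing.ResidueField P.ring) := by
  obtain ⟨x, hx⟩ := P.exists_uniformizer
  have hx0 : x ≠ 0 := by rintro rfl; exact absurd hx.symm (by simp)
  have htr : Transcendental k x := fun h => by
    rw [P.valuation_eq_one_of_isAlgebraic h hx0, ← exp_zero] at hx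
    exact absurd (exp_injective hx) (by omega)
  have := hF.finiteDimensional_adjoin htr
  refine Module.rank_lt_aleph0_iff.1 (lt_of_le_of_lt (b :=
    ((Module.finrank (IntermediateField.adjoin k {x}) F : ℕ) : Cardinal)) ?_
    (Cardinal.natCast_lt_aleph0))
  refine rank_le fun s hs => ?_
  classical
  let b (Q : Place k F) : Fin (if Q = P then s.card else 0) → IsLocalRing.ResidueField Q.ring :=
    if h : Q = P then fun j => h ▸ (s.equivFin.symm (Fin.cast (by simp [h]) j) : _)
    else fun j => 0
  have := Place.sum_mul_le_finrank htr {P} (fun _ => 1) (by simp [hx])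
    (fun Q => if Q = P then s.card else 0) b (by
      intro Q hQ
      obtain rfl := Finset.mem_singleton.1 hQ
      simp only [b, dite_true]
      exact hs.comp (fun j => s.equivFin.symm (Fin.cast (if_pos rfl) j))
        (s.equivFin.symm.injective.comp (Fin.cast_injective _)))
  simpa using this

lemma IsFunctionField.degree_pos (hF : IsFunctionField k F) (P : Place k F) : 0 < P.degree := by
  have := hF.finite_residueField P
  exact Module.finrank_pos

/-- The zeros of `x` on a finite set of places, counted with degrees, are at most `[F : k(x)]`
in number. -/
lemma IsFunctionField.sum_mul_degree_le (hF : IsFunctionField k F) {x : F}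
    (hx : Transcendental k x) (S : Finset (Place k F))
    (m : Place k F → ℕ) (hm : ∀ P ∈ S, P.valuation x ≤ exp (-(m P : ℤ))) :
    ∑ P ∈ S, m P * P.degree ≤ Module.finrank (IntermediateField.adjoin k {x}) F := by
  have := hF.finiteDimensional_adjoin hx
  have := hF.finite_residueField
  exact Place.sum_mul_le_finrank hx S m hm Place.degree
    (fun P => Module.finBasis k (IsLocalRing.ResidueField P.ring))
    fun P _ => (Module.finBasis k _).linearIndependent

end AlgFunField

/-! ### Dimensions of Riemann–Roch spaces and the degree bound for zeros. -/

namespace AlgFunField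

open scoped WithZero
open WithZero Filter

variable {k F : Type*} [Field k] [Field F] [Algebra k F]

namespace Divisor

lemma mem_rrSpace {D : Divisor k F} {f : F} :
    f ∈ D.rrSpace ↔ ∀ P : Place k F, P.valuation f ≤ exp (D P) := Iff.rfl

lemma rrSpace_mono {D E : Divisor k F} (h : D ≤ E) : D.rrSpace ≤ E.rrSpace :=
  fun _ hf P => (hf P).trans (exp_le_exp.2 (h P))

lemma mul_mem_rrSpace {D E : Divisor k F} {f g : F} (hf : f ∈ D.rrSpace) (hg : g ∈ E.rrSpace) :
    f * g ∈ (D + E).rrSpace := fun P => by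
  rw [map_mul, Finsupp.add_apply, exp_add]
  exact mul_le_mul' (hf P) (hg P)

lemma one_mem_rrSpace : (1 : F) ∈ (0 : Divisor k F).rrSpace := fun P => by simp

lemma pow_mem_rrSpace {D : Divisor k F} {f : F} (hf : f ∈ D.rrSpace) (n : ℕ) :
    f ^ n ∈ (n • D).rrSpace := by
  induction n with
  | zero => simpa using one_mem_rrSpace
  | succ n ih => rw [pow_succ, succ_nsmul]; exact mul_mem_rrSpace ih hf

lemma degree_add (D E : Divisor k F) : (D + E).degree = D.degree + E.degree :=
  Finsupp.sum_add_index' (by simp) (by intros; ring)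

lemma degree_single (P : Place k F) (m : ℤ) :
    degree (Finsupp.single P m) = m * P.degree := by simp [degree]

lemma degree_zero : (0 : Divisor k F).degree = 0 := by simp [degree]

lemma degree_nsmul (n : ℕ) (D : Divisor k F) : (n • D).degree = n * D.degree := by
  induction n with
  | zero => simp [degree_zero]
  | succ n ih => rw [succ_nsmul, degree_add, ih]; push_cast; ring

lemma degree_nonneg {D : Divisor k F} (hD : 0 ≤ D) : 0 ≤ D.degree :=
  Finset.sum_nonneg fun P _ => mul_nonneg (hD P) (Int.natCast_nonneg _)

/-- A nonnegative divisor is a sum of places. -/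
lemma induction_nonneg {p : Divisor k F → Prop} (h0 : p 0)
    (hadd : ∀ D P, 0 ≤ D → p D → p (D + Finsupp.single P 1)) {D : Divisor k F} (hD : 0 ≤ D) :
    p D := by
  have hmul (E : Divisor k F) (P : Place k F) (hE : 0 ≤ E) (hp : p E) (n : ℕ) :
      0 ≤ E + Finsupp.single P (n : ℤ) ∧ p (E + Finsupp.single P (n : ℤ)) := by
    induction n with
    | zero => simpa using ⟨hE, hp⟩
    | succ n ih =>
      refine ⟨add_nonneg hE (Finsupp.single_nonneg.2 (by positivity)), ?_⟩
      have := hadd _ P ih.1 ih.2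
      rwa [add_assoc, ← Finsupp.single_add] at this
  suffices ∀ S : Finset (Place k F),
      0 ≤ (∑ P ∈ S, Finsupp.single P (D P) : Divisor k F) ∧ p (∑ P ∈ S, Finsupp.single P (D P)) by
    have h := (this D.support).2
    rwa [show (∑ P ∈ D.support, Finsupp.single P (D P)) = D from D.sum_single] at h
  classical
  intro S
  induction S using Finset.induction_on with
  | empty => simpa using h0
  | insert P S hP ih =>
    rw [Finset.sum_insert hP, add_comm]
    have := hmul _ P ih.1 ih.2 (D P).toNat
    rwa [Int.toNat_of_nonneg (hD P)] at this

end Divisor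

open Divisor

/-- `L(D + P) / L(D)` embeds into the residue field of `P`. -/
lemma rrSpace_add_single [∀ P : Place k F, Module.Finite k (IsLocalRing.ResidueField P.ring)]
    (D : Divisor k F) (P : Place k F) [FiniteDimensional k D.rrSpace] :
    FiniteDimensional k (D + Finsupp.single P 1).rrSpace ∧
    Module.finrank k (D + Finsupp.single P 1).rrSpace ≤
      Module.finrank k D.rrSpace + P.degree := by
  classical
  obtain ⟨π, hπ⟩ := P.exists_uniformizer
  set E := D + Finsupp.single P 1 with hE
  have hEP : E P = D P + 1 := by simp [hE]
  have hπ0 : P.valuation (π ^ (E P)) = exp (-(E P)) := by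
    rw [map_zpow₀, hπ, ← exp_zsmul]; simp
  have hval (f : E.rrSpace) : P.valuation ((f : F) * π ^ (E P)) ≤ 1 := by
    have := mul_le_mul_left (f.2 P) (exp (-(E P)))
    rw [map_mul, hπ0]
    rwa [← exp_add, add_neg_cancel, exp_zero] at this
  -- The leading coefficient at `P`: it vanishes only when the pole order drops to at most `D P`.
  let φ : E.rrSpace →ₗ[k] IsLocalRing.ResidueField P.ring :=
    { toFun := fun f => IsLocalRing.residue P.ring ⟨f * π ^ (E P), P.mem_ring_iff.2 (hval f)⟩
      map_add' := fun f g => by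
        rw [← map_add]; congr 1; ext; simp [add_mul]
      map_smul' := fun c f => by
        rw [RingHom.id_apply, ← P.residue_smul]; congr 1; ext; simp [P.coe_smul] }
  have hker : ∀ f, φ f = 0 → (f : F) ∈ D.rrSpace := by
    intro f hf Q
    by_cases hQ : Q = P
    · subst hQ
      have h1 := (Q.residue_eq_zero_iff _).1 hf
      rw [lt_one_iff_le_exp_neg_one] at h1
      have h2 := mul_le_mul_left h1 (exp (E Q))
      rwa [map_mul, hπ0, mul_assoc, ← exp_add, ← exp_add, neg_add_cancel, exp_zero, mul_one,
        hEP, neg_add_cancel_comm_assoc] at h2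
    · have hEQ : E Q = D Q := by simp [hE, Ne.symm hQ]
      exact hEQ ▸ f.2 Q
  let ψ : LinearMap.ker φ →ₗ[k] D.rrSpace :=
    { toFun := fun f => ⟨f.1, hker f.1 f.2⟩
      map_add' := fun _ _ => rfl
      map_smul' := fun _ _ => rfl }
  have hψ : Function.Injective ψ := fun f g h =>
    Subtype.ext (Subtype.ext (congrArg (fun z : D.rrSpace => (z : F)) h))
  have : FiniteDimensional k (LinearMap.ker φ) := Module.Finite.of_injective ψ hψ
  have : FiniteDimensional k (E.rrSpace ⧸ LinearMap.ker φ) :=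
    Module.Finite.equiv φ.quotKerEquivRange.symm
  have hfin : FiniteDimensional k E.rrSpace := .of_submodule_quotient (LinearMap.ker φ)
  refine ⟨hfin, ?_⟩
  have h1 := φ.finrank_range_add_finrank_ker
  have h2 := LinearMap.finrank_le_finrank_of_injective hψ
  have h3 : Module.finrank k (LinearMap.range φ) ≤ P.degree := Submodule.finrank_le _
  omega

/-- `dim L(D) ≤ deg D + 1` for `D ≥ 0`. -/
lemma IsFunctionField.finrank_rrSpace_le (hF : IsFunctionField k F)
    (hconst : algebraicClosure k F = ⊥) {D : Divisor k F} (hD : 0 ≤ D) :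
    FiniteDimensional k D.rrSpace ∧ (Module.finrank k D.rrSpace : ℤ) ≤ D.degree + 1 := by
  have := hF.finite_residueField
  refine induction_nonneg (p := fun D => FiniteDimensional k D.rrSpace ∧
    (Module.finrank k D.rrSpace : ℤ) ≤ D.degree + 1) ?_ (fun D P _ h => ?_) hD
  -- A transcendental function has a pole, so `L(0)` consists of algebraic elements, which are
  -- constants.
  · have hle : (0 : Divisor k F).rrSpace ≤ Submodule.span k {1} := by
      intro f hf
      have halg : IsAlgebraic k f := by
        by_contra h
        obtain ⟨P, hP⟩ := hF.exists_place_one_lt_valuation h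
        exact hP.not_ge (by simpa using hf P)
      rw [← mem_algebraicClosure_iff, hconst, IntermediateField.mem_bot] at halg
      obtain ⟨c, rfl⟩ := halg
      exact Submodule.mem_span_singleton.2 ⟨c, by rw [Algebra.smul_def, mul_one]⟩
    refine ⟨Submodule.finiteDimensional_of_le hle, ?_⟩
    have h1 := Submodule.finrank_mono hle
    have h2 := finrank_span_singleton (K := k) (one_ne_zero (α := F))
    rw [degree_zero]
    omega
  · have := h.1
    obtain ⟨h1, h2⟩ := rrSpace_add_single D P
    refine ⟨h1, ?_⟩
    rw [degree_add, degree_single]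
    have := h.2
    omega

/-- Every element has finitely many poles, and so lies in some `L(C)` with `C ≥ 0`. -/
lemma IsFunctionField.exists_mem_rrSpace (hF : IsFunctionField k F) (f : F) :
    ∃ C : Divisor k F, 0 ≤ C ∧ f ∈ C.rrSpace := by
  have hfin : {P : Place k F | 1 < P.valuation f}.Finite := by
    by_cases halg : IsAlgebraic k f
    · refine Set.finite_empty.subset fun P hP => ?_
      exact absurd (P.valuation_le_one_of_isAlgebraic halg) (not_le.2 hP)
    by_contra hinf
    have htr : Transcendental k f⁻¹ := fun h => halg (by simpa using h.inv)
    obtain ⟨T, hT, hcard⟩ := Set.Infinite.exists_subset_card_eq hinf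
      (Module.finrank (IntermediateField.adjoin k {f⁻¹}) F + 1)
    have h1 := hF.sum_mul_degree_le htr T (fun _ => 1) (fun P hP => by
      have h : 1 < P.valuation f := hT hP
      rw [Nat.cast_one, ← lt_one_iff_le_exp_neg_one, map_inv₀]
      exact inv_lt_one_of_one_lt₀ h)
    have h2 : T.card ≤ ∑ P ∈ T, 1 * P.degree := by
      rw [Finset.card_eq_sum_ones]
      exact Finset.sum_le_sum fun P _ => by have := hF.degree_pos P; omega
    omega
  refine ⟨Finsupp.onFinset hfin.toFinset (fun P => max 0 (log (P.valuation f))) fun P hP => ?_,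
    fun P => by simp, fun P => ?_⟩
  · rw [Set.Finite.mem_toFinset, Set.mem_ofPred_eq]
    have h0 : P.valuation f ≠ 0 := fun h => hP (by simp [h])
    rw [← exp_zero, ← lt_log_iff_exp_lt h0]
    by_contra h
    exact hP (max_eq_left (not_lt.1 h))
  · exact le_exp_of_log_le (by simp)

lemma linearIndependent_pow_mul {f : F} (hf : Transcendental k f) {ι : Type*} {u : ι → F}
    (hu : LinearIndependent (IntermediateField.adjoin k {f}) u) :
    LinearIndependent k fun p : ℕ × ι => f ^ p.1 * u p.2 := by
  have h : LinearIndependent k fun j : ℕ => f ^ j := by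
    have := (Polynomial.basisMonomials k).linearIndependent.map'
      (Polynomial.aeval f).toLinearMap (LinearMap.ker_eq_bot.2 (transcendental_iff_injective.1 hf))
    simpa [Function.comp_def] using this
  have hpow : LinearIndependent k
      fun j : ℕ => (IntermediateField.AdjoinSimple.gen k f) ^ j :=
    LinearIndependent.of_comp (IntermediateField.val _).toLinearMap (by
      simpa [Function.comp_def] using h)
  exact linearIndependent_smul hpow hu

/-- `[F : k(f)] ≤ deg G` if the poles of `f` are bounded by `G`. -/
lemma IsFunctionField.finrank_adjoin_le_degree (hF : IsFunctionField k F)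
    (hconst : algebraicClosure k F = ⊥) {f : F} (hf : Transcendental k f) {G : Divisor k F}
    (hG : 0 ≤ G) (hfG : f ∈ G.rrSpace) :
    (Module.finrank (IntermediateField.adjoin k {f}) F : ℤ) ≤ G.degree := by
  have := hF.finiteDimensional_adjoin hf
  set n := Module.finrank (IntermediateField.adjoin k {f}) F
  let u := Module.finBasis (IntermediateField.adjoin k {f}) F
  choose C hC0 hC using fun i => hF.exists_mem_rrSpace (k := k) (u i)
  set E : Divisor k F := ∑ i, C i
  have hE0 : 0 ≤ E := Finset.sum_nonneg fun i _ => hC0 i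
  have huE (i) : u i ∈ E.rrSpace :=
    rrSpace_mono (Finset.single_le_sum (fun i _ => hC0 i) (Finset.mem_univ i)) (hC i)
  -- The products `f ^ a * u i` with `a ≤ l` lie in `L(E + lG)` and are independent over `k`. The
  -- slopes in `l` then force `n ≤ deg G`.
  have hbound (l : ℕ) : (n : ℤ) * (l + 1) ≤ E.degree + l * G.degree + 1 := by
    have hlG : 0 ≤ l • G := nsmul_nonneg hG l
    obtain ⟨hfd, hle⟩ := hF.finrank_rrSpace_le hconst (add_nonneg hE0 hlG)
    have hind : LinearIndependent k fun p : Fin (l + 1) × Fin n => f ^ (p.1 : ℕ) * u p.2 :=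
      (linearIndependent_pow_mul hf u.linearIndependent).comp
        (fun p : Fin (l + 1) × Fin n => ((p.1 : ℕ), p.2))
        (Fin.val_injective.prodMap Function.injective_id)
    have hmem (p : Fin (l + 1) × Fin n) : f ^ (p.1 : ℕ) * u p.2 ∈ (E + l • G).rrSpace := by
      rw [mul_comm]
      refine mul_mem_rrSpace (huE _) (rrSpace_mono ?_ (pow_mem_rrSpace hfG _))
      exact nsmul_le_nsmul_left hG (by omega)
    have hind' : LinearIndependent k
        fun p : Fin (l + 1) × Fin n => (⟨_, hmem p⟩ : (E + l • G).rrSpace) :=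
      LinearIndependent.of_comp (Submodule.subtype _) hind
    have hcard := hind'.fintype_card_le_finrank
    rw [Fintype.card_prod, Fintype.card_fin, Fintype.card_fin] at hcard
    rw [degree_add, degree_nsmul] at hle
    have : ((l + 1) * n : ℤ) ≤ Module.finrank k (E + l • G).rrSpace := by exact_mod_cast hcard
    linarith
  by_contra! hlt
  -- If `n ≥ deg G + 1`, the left side at `l = deg E + 1` is at least `l deg G + deg G + deg E + 2`,
  -- which is too large.
  have h1 := hbound (E.degree + 1).toNat
  have hE1 := degree_nonneg hE0
  rw [Int.toNat_of_nonneg (by omega)] at h1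
  have h2 : (n : ℤ) ≥ G.degree + 1 := hlt
  have h3 := degree_nonneg hG
  nlinarith

/-- A nonzero function with poles bounded by `G` has at most `deg G` zeros. -/
lemma IsFunctionField.sum_mul_degree_le_degree (hF : IsFunctionField k F)
    (hconst : algebraicClosure k F = ⊥) {f : F} (hf : f ≠ 0) {G : Divisor k F}
    (hG : 0 ≤ G) (hfG : f ∈ G.rrSpace) (S : Finset (Place k F))
    (m : Place k F → ℕ) (hm : ∀ P ∈ S, P.valuation f ≤ exp (-(m P : ℤ))) :
    ((∑ P ∈ S, m P * P.degree : ℕ) : ℤ) ≤ G.degree := by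
  by_cases halg : IsAlgebraic k f
  · have h0 : ∀ P ∈ S, m P * P.degree = 0 := fun P hP => by
      have := hm P hP
      rw [P.valuation_eq_one_of_isAlgebraic halg hf, ← exp_zero, exp_le_exp] at this
      have : m P = 0 := by omega
      rw [this, zero_mul]
    rw [Finset.sum_eq_zero h0]
    exact degree_nonneg hG
  · exact (Int.ofNat_le.2 (hF.sum_mul_degree_le halg S m hm)).trans
      (hF.finrank_adjoin_le_degree hconst halg hG hfG)

end AlgFunField

/-! ### The Casorati determinant: nonvanishing, poles and zeros. -/

namespace AlgFunField

open scoped WithZero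
open WithZero

variable {k F : Type*} [Field k] [Field F] [Algebra k F]

lemma Place.LiesAbove.valuation_lt_one {K : IntermediateField k F} {Q' : Place k F} {Q : Place k K}
    (h : Q'.LiesAbove Q) {x : K} (hx : Q.valuation x < 1) : Q'.valuation (x : F) < 1 := by
  rcases eq_or_ne x 0 with rfl | hx0
  · simp
  by_contra! hle
  have h1 : x⁻¹ ∈ Q.ring := by
    rw [← h, ValuationSubring.mem_comap, Q'.mem_ring_iff, map_inv₀, map_inv₀]
    exact inv_le_one_of_one_le₀ hle
  rw [Q.mem_ring_iff, map_inv₀, inv_le_one₀ (by simpa [zero_lt_iff] using hx0)] at h1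
  exact hx.not_ge h1

lemma Place.exists_valuation_sub_algebraMap_lt_one (Q : Place k F) (hQ : Q.degree = 1) {a : F}
    (ha : Q.valuation a ≤ 1) : ∃ c : k, Q.valuation (a - algebraMap k F c) < 1 := by
  obtain ⟨c, hc⟩ := (finrank_eq_one_iff_of_nonzero' (1 : IsLocalRing.ResidueField Q.ring)
    one_ne_zero).1 hQ (IsLocalRing.residue Q.ring ⟨a, Q.mem_ring_iff.2 ha⟩)
  refine ⟨c, ?_⟩
  have h : IsLocalRing.residue Q.ring (⟨a, Q.mem_ring_iff.2 ha⟩ - c • 1) = 0 := by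
    rw [map_sub, ← hc, Q.residue_smul, map_one, sub_self]
  have := (Q.residue_eq_zero_iff _).1 h
  rwa [AddSubgroupClass.coe_sub, Q.coe_smul, OneMemClass.coe_one, Algebra.smul_def,
    mul_one] at this

/-- If only `0 ∈ V` vanishes at a place above a rational place of `K`, then elements of `V` that are
linearly independent over `k` are linearly independent over `K`. -/
lemma linearIndependent_of_rational_place {K : IntermediateField k F} {Q : Place k K}
    (hQ : Q.degree = 1) {Q' : Place k F} (hQ' : Q'.LiesAbove Q) {V : Submodule k F}
    (hreg : ∀ f ∈ V, Q'.valuation f ≤ 1) (hV : ∀ f ∈ V, Q'.valuation f < 1 → f = 0)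
    {ι : Type*} [Fintype ι] {f : ι → F} (hfV : ∀ i, f i ∈ V) (hf : LinearIndependent k f) :
    LinearIndependent K f := by
  rw [Fintype.linearIndependent_iff] at hf ⊢
  intro g hg
  by_contra! hne
  obtain ⟨i₁, hi₁⟩ := hne
  -- Dividing by a coefficient of largest value makes all of them regular at `Q`, with a `1` at
  -- `i₀`. Replacing them by their residues in `k` changes the sum by something vanishing at `Q'`,
  -- so the resulting combination is `0`, against the residue `1` at `i₀`.
  obtain ⟨i₀, -, hmax⟩ := Finset.univ.exists_max_image (fun i => Q.valuation (g i))
    ⟨i₁, Finset.mem_univ _⟩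
  have h0 : g i₀ ≠ 0 := by
    intro h
    have := hmax i₁ (Finset.mem_univ _)
    rw [h, map_zero, le_zero_iff, Valuation.zero_iff] at this
    exact hi₁ this
  have ha (i : ι) : Q.valuation (g i / g i₀) ≤ 1 := by
    rw [map_div₀, div_le_one₀ (by simpa [zero_lt_iff] using h0)]
    exact hmax i (Finset.mem_univ _)
  choose c hc using fun i => Q.exists_valuation_sub_algebraMap_lt_one hQ (ha i)
  have hsum : ∑ i, ((g i / g i₀ : K) : F) * f i = 0 := by
    have : ∑ i, ((g i / g i₀ : K) : F) * f i = (g i₀ : F)⁻¹ * ∑ i, g i • f i := by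
      rw [Finset.mul_sum]
      refine Finset.sum_congr rfl fun i _ => ?_
      rw [Algebra.smul_def, IntermediateField.coe_div, div_eq_inv_mul, mul_assoc]; rfl
    rw [this, hg, mul_zero]
  have hdiff : ∑ i, c i • f i =
      -∑ i, ((g i / g i₀ - algebraMap k K (c i) : K) : F) * f i := by
    rw [eq_neg_iff_add_eq_zero, ← Finset.sum_add_distrib, ← hsum]
    refine Finset.sum_congr rfl fun i _ => ?_
    rw [Algebra.smul_def, ← add_mul, AddSubgroupClass.coe_sub]
    congr 1
    exact add_sub_cancel _ _
  have hlt : Q'.valuation (∑ i, c i • f i) < 1 := by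
    rw [hdiff, Valuation.map_neg]
    refine Valuation.map_sum_lt _ one_ne_zero fun i _ => ?_
    rw [map_mul]
    exact (mul_le_of_le_one_right' (hreg _ (hfV i))).trans_lt (hQ'.valuation_lt_one (hc i))
  have hc0 := hf c (hV _ (sum_mem fun i _ => V.smul_mem _ (hfV i)) hlt) i₀
  have := hc i₀
  rw [hc0, div_self h0, map_zero, sub_zero, map_one] at this
  exact lt_irrefl _ this

/-- Each Leibniz term takes exactly one entry from each row. -/
lemma Valuation.map_det_le_prod {R Γ : Type*} [CommRing R] [LinearOrderedCommGroupWithZero Γ]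
    (v : Valuation R Γ) {n : Type*} [Fintype n] [DecidableEq n] (M : Matrix n n R) (c : n → Γ)
    (h : ∀ i j, v (M i j) ≤ c i) : v M.det ≤ ∏ i, c i := by
  rw [Matrix.det_apply]
  refine Valuation.map_sum_le _ fun τ _ => ?_
  have h1 : v (Equiv.Perm.sign τ • ∏ i, M (τ i) i) = v (∏ i, M (τ i) i) := by
    rcases Int.units_eq_one_or (Equiv.Perm.sign τ) with h | h <;> simp [h, Valuation.map_neg]
  rw [h1, map_prod, ← Equiv.prod_comp τ c]
  exact Finset.prod_le_prod' fun i _ => h _ _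

/-- The matrix of the conjugates `σ ^ j (f i)`. -/
def casorati (σ : F ≃ₐ[k] F) {s : ℕ} (f : Fin s → F) : Matrix (Fin s) (Fin s) F :=
  Matrix.of fun i j => (σ ^ (j : ℕ)) (f i)

/-- As `σ` fixes constants, a change of basis over `k` scales the determinant by a nonzero constant
and preserves its valuations. -/
lemma casorati_sum (σ : F ≃ₐ[k] F) {s : ℕ} (f : Fin s → F) (A : Matrix (Fin s) (Fin s) k) :
    casorati σ (fun i => ∑ l, A i l • f l) = A.map (algebraMap k F) * casorati σ f := by
  ext i j
  simp only [casorati, Matrix.of_apply, map_sum, Matrix.mul_apply, Matrix.map_apply,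
    Algebra.smul_def, map_mul, AlgEquiv.commutes]

lemma exists_basis_of_submodule {E : Type*} [AddCommGroup E] [Module k E] [FiniteDimensional k E]
    {s : ℕ} (hs : Module.finrank k E = s) (U : Submodule k E) :
    ∃ b : Module.Basis (Fin s) k E, ∀ i : Fin s, (i : ℕ) < Module.finrank k U → b i ∈ U := by
  obtain ⟨C, hC⟩ := U.exists_isCompl
  have hadd : Module.finrank k U + Module.finrank k C = s := by
    rw [Submodule.finrank_add_eq_of_isCompl hC, hs]
  let b := (((Module.finBasis k U).prod (Module.finBasis k C)).map
    (Submodule.prodEquivOfIsCompl U C hC)).reindex (finSumFinEquiv.trans (finCongr hadd))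
  refine ⟨b, fun i hi => ?_⟩
  have : (finSumFinEquiv.trans (finCongr hadd)).symm i = Sum.inl ⟨i, hi⟩ := by
    rw [Equiv.symm_apply_eq]; ext; simp
  rw [Module.Basis.reindex_apply, this]
  simp

lemma linearIndependent_coe_coe {E : Type*} [AddCommGroup E] [Module k E] {V : Submodule k E}
    {W : Submodule k V} {ι : Type*} {b : ι → W} (hb : LinearIndependent k b) :
    LinearIndependent k fun i => ((b i : V) : E) := by
  have h : LinearIndependent k fun i => (b i : V) := hb.map' W.subtype W.ker_subtype
  exact h.map' V.subtype V.ker_subtype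

namespace Place

lemma valuation_conj_zpow_neg (P : Place k F) (σ : F ≃ₐ[k] F) (i : ℕ) (f : F) :
    (P.conj (σ ^ (-(i : ℤ)))).valuation f = P.valuation ((σ ^ i) f) := by
  rw [valuation_conj]
  change P.valuation ((σ ^ (-(i : ℤ)))⁻¹ f) = _
  rw [zpow_neg, inv_inv, zpow_natCast]

lemma orbitSet_eq_image (P : Place k F) (σ : F ≃ₐ[k] F) (t : ℕ) :
    P.orbitSet σ t = (fun i : ℕ => P.conj (σ ^ (-(i : ℤ)))) '' (Finset.range t : Set ℕ) := by
  ext R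
  simp [orbitSet, eq_comm]

/-- The residue classes at `P` of the functions in a space of functions regular at `P`. -/
noncomputable def evalHom (P : Place k F) (V : Submodule k F)
    (hV : ∀ f ∈ V, P.valuation f ≤ 1) : V →ₗ[k] IsLocalRing.ResidueField P.ring where
  toFun f := IsLocalRing.residue P.ring ⟨f, P.mem_ring_iff.2 (hV f f.2)⟩
  map_add' f g := by rw [← map_add]; rfl
  map_smul' c f := by
    rw [RingHom.id_apply, ← P.residue_smul]; congr 1; ext; simp [P.coe_smul]

lemma evalHom_eq_zero_iff (P : Place k F) (V : Submodule k F)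
    (hV : ∀ f ∈ V, P.valuation f ≤ 1) (f : V) :
    P.evalHom V hV f = 0 ↔ P.VanishesAt (f : F) := by
  rw [vanishesAt_iff_valuation_lt]; exact P.residue_eq_zero_iff _

end Place

namespace Divisor

variable {D : Divisor k F} {σ : F ≃ₐ[k] F}

lemma apply_conj (hD : D.conj σ = D) (P : Place k F) : D (P.conj σ) = D P := by
  conv_lhs => rw [← hD]
  refine Finsupp.mapDomain_apply (fun A B h => ?_) D P
  have := congrArg (fun R => R.conj σ⁻¹) h
  simpa [Place.conj_conj, Place.conj_one] using this

lemma apply_conj_zpow_neg (hD : D.conj σ = D) (P : Place k F) (i : ℕ) :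
    D (P.conj (σ ^ (-(i : ℤ)))) = D P := by
  have h (R : Place k F) : D (R.conj (σ ^ i)) = D R := by
    induction i with
    | zero => rw [pow_zero, Place.conj_one]
    | succ i ih => rw [pow_succ', ← Place.conj_conj, apply_conj hD, ih]
  rw [← h, Place.conj_conj, zpow_neg, zpow_natCast, mul_inv_cancel, Place.conj_one]

lemma pow_apply_mem_rrSpace (hD : D.conj σ = D) {f : F} (hf : f ∈ D.rrSpace) (j : ℕ) :
    (σ ^ j) f ∈ D.rrSpace := fun P => by
  rw [← P.valuation_conj_zpow_neg, ← apply_conj_zpow_neg hD P j]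
  exact hf _

lemma det_casorati_mem_rrSpace (hD : D.conj σ = D) {s : ℕ} {f : Fin s → F}
    (hf : ∀ i, f i ∈ D.rrSpace) : (casorati σ f).det ∈ (s • D).rrSpace := fun P => by
  refine (Valuation.map_det_le_prod _ _ (fun _ => exp (D P)) fun i j =>
    pow_apply_mem_rrSpace hD (hf i) j P).trans_eq ?_
  rw [Finset.prod_const, Finset.card_univ, Fintype.card_fin, ← exp_nsmul, Finsupp.smul_apply]

end Divisor

/-- `H_P` is the kernel of joint evaluation at `t` conjugate places, whose residue fields all have
dimension `deg P`. -/
lemma rank_quotient_vanishingSubspace_le (hF : IsFunctionField k F) (V : Submodule k F)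
    (σ : F ≃ₐ[k] F) (t : ℕ) (P : Place k F)
    (hreg : ∀ i : ℕ, ∀ f ∈ V, (P.conj (σ ^ (-(i : ℤ)))).valuation f ≤ 1) :
    Module.rank k (V ⧸ vanishingSubspace V σ t P) ≤ ((P.degree * t : ℕ) : Cardinal) := by
  have := hF.finite_residueField
  let φ := LinearMap.pi fun i : Fin t => (P.conj (σ ^ (-((i : ℕ) : ℤ)))).evalHom V (hreg i)
  have hker : LinearMap.ker φ = vanishingSubspace V σ t P := by
    ext f
    rw [LinearMap.mem_ker, funext_iff]
    simp only [φ, LinearMap.pi_apply, Pi.zero_apply, Place.evalHom_eq_zero_iff]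
    exact ⟨fun h i hi => h ⟨i, hi⟩, fun h i => h i i.2⟩
  rw [← hker, φ.quotKerEquivRange.rank_eq]
  refine (Submodule.rank_le _).trans_eq ?_
  rw [← Module.finrank_eq_rank, Module.finrank_pi_fintype]
  have (i : Fin t) : Module.finrank k (IsLocalRing.ResidueField
    (P.conj (σ ^ (-((i : ℕ) : ℤ)))).ring) = P.degree := P.degree_conj _
  simp [this, mul_comm]

lemma prod_ite_lt_exp {s d : ℕ} (hd : d ≤ s) :
    ∏ i : Fin s, (if (i : ℕ) < d then exp (-1) else 1 : ℤᵐ⁰) = exp (-(d : ℤ)) := by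
  rw [Fin.prod_univ_eq_prod_range (fun i => (if i < d then exp (-1) else 1 : ℤᵐ⁰)) s,
    ← Finset.prod_subset (s₁ := Finset.range d) (by simpa using hd)
      (by intro i _ hi; simp at hi; simp [hi])]
  rw [Finset.prod_congr rfl (g := fun _ => exp (-1)) (by intro i hi; simp_all), Finset.prod_const,
    Finset.card_range, ← exp_nsmul]
  simp

/-- The Casorati determinant of a basis of `W` vanishes at `P^{σ^{-i}}`, `i ≤ t - s`, to order at
least `dim (W ∩ H_P)`. -/
lemma valuation_det_casorati_le {V : Submodule k F} {σ : F ≃ₐ[k] F} {s t : ℕ}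
    {P : Place k F} (hreg : ∀ i : ℕ, ∀ f ∈ V, (P.conj (σ ^ (-(i : ℤ)))).valuation f ≤ 1)
    (W : Submodule k V) [FiniteDimensional k W] (hW : Module.finrank k W = s)
    (hdet : ∀ b : Module.Basis (Fin s) k W, (casorati σ fun i => ((b i : V) : F)).det ≠ 0)
    (b : Module.Basis (Fin s) k W) {i : ℕ} (hi : i + s ≤ t) :
    (P.conj (σ ^ (-(i : ℤ)))).valuation (casorati σ fun i => ((b i : V) : F)).det ≤
      exp (-(Module.finrank k ↥(W ⊓ vanishingSubspace V σ t P) : ℤ)) := by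
  obtain ⟨g, hg⟩ := exists_basis_of_submodule (E := W) hW
    (Submodule.comap W.subtype (vanishingSubspace V σ t P))
  have hfr : Module.finrank k (Submodule.comap W.subtype (vanishingSubspace V σ t P)) =
      Module.finrank k ↥(W ⊓ vanishingSubspace V σ t P) := by
    rw [← Submodule.map_comap_subtype]
    exact (Submodule.finrank_map_subtype_eq _ _).symm
  rw [hfr] at hg
  have hle : Module.finrank k ↥(W ⊓ vanishingSubspace V σ t P) ≤ s := by
    rw [← hW]; exact Submodule.finrank_mono inf_le_left
  set Pi := P.conj (σ ^ (-(i : ℤ))) with hPi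
  let A : Matrix (Fin s) (Fin s) k := Matrix.of fun i l => b.repr (g i) l
  have hgb : (fun i => ((g i : V) : F)) = fun i => ∑ l, A i l • ((b l : V) : F) := by
    funext i
    conv_lhs => rw [← b.sum_repr (g i)]
    simp only [AddSubmonoidClass.coe_finsetSum, Submodule.coe_smul, A, Matrix.of_apply]
  have hmul : (casorati σ fun i => ((g i : V) : F)).det =
      algebraMap k F A.det * (casorati σ fun i => ((b i : V) : F)).det := by
    rw [hgb, casorati_sum, Matrix.det_mul, RingHom.map_det]; rfl
  -- Invertibility of the base change is read off from `hdet` for the adapted basis `g`.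
  have hA : A.det ≠ 0 := by
    intro h
    refine hdet g ?_
    rw [hmul, h, map_zero, zero_mul]
  have hval : Pi.valuation (casorati σ fun i => ((g i : V) : F)).det =
      Pi.valuation (casorati σ fun i => ((b i : V) : F)).det := by
    rw [hmul, map_mul, Pi.valuation_algebraMap hA, one_mul]
  rw [← hval, ← prod_ite_lt_exp hle]
  refine Valuation.map_det_le_prod _ _ _ fun l j => ?_
  -- The shift index `i + j` stays below `t` because `j < s` and `i + s ≤ t`. Hence all entries of
  -- an adapted row vanish at this place.
  have hconj : Pi.valuation (casorati σ (fun i => ((g i : V) : F)) l j) =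
      (P.conj (σ ^ (-((i + j : ℕ) : ℤ)))).valuation ((g l : V) : F) := by
    rw [hPi, Place.valuation_conj_zpow_neg, Place.valuation_conj_zpow_neg, pow_add]
    rfl
  rw [hconj]
  split_ifs with hl
  · rw [← lt_one_iff_le_exp_neg_one, ← Place.vanishesAt_iff_valuation_lt]
    exact hg l hl (i + j) (by omega)
  · exact hreg _ _ (g l : V).2

end AlgFunField

/-! ### The strong subspace design. -/

open AlgFunField in
theorem theorem3p6 {k F : Type*} [Field k] [Finite k] [Field F] [Algebra k F]
    (hF : IsFunctionField k F) (hconst : algebraicClosure k F = ⊥)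
    (σ : F ≃ₐ[k] F) (hσ : IsOfFinOrder σ)
    (Q : Place k (IntermediateField.fixedField (Subgroup.zpowers σ))) (hQ : Q.degree = 1)
    (Q' : Place k F) (hQ' : Q'.LiesAbove Q)
    (D : Divisor k F) (hD : 0 ≤ D) (hDQ' : Q' ∉ D.support) (hDσ : D.conj σ = D)
    (V : Submodule k F) (hVD : V ≤ D.rrSpace)
    (hV : V ⊓ Divisor.rrSpace (D - Finsupp.single Q' 1) = ⊥)
    (r s t : ℕ) (hs : 1 ≤ s) (hst : s ≤ t)
    (𝓕 : Set (Place k F))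
    (h𝓕D : ∀ P ∈ 𝓕, P ∉ D.support)
    (h𝓕r : ∀ P ∈ 𝓕, P.degree = r)
    (h𝓕t : ∀ P ∈ 𝓕, (P.orbitSet σ t).ncard = t)
    (h𝓕disj : 𝓕.PairwiseDisjoint (Place.orbitSet σ t)) :
    (∀ P ∈ 𝓕, Module.rank k (V ⧸ vanishingSubspace V σ t P) ≤ ((r * t : ℕ) : Cardinal)) ∧
      IsStrongSubspaceDesign (fun P : 𝓕 => vanishingSubspace V σ t (P : Place k F)) s
        ((D.degree : ℝ) * s / (r * ((t : ℝ) - s + 1))) := by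
  classical
  have hreg {P : Place k F} (hP : P ∈ 𝓕) (i : ℕ) :
      ∀ f ∈ V, (P.conj (σ ^ (-(i : ℤ)))).valuation f ≤ 1 := fun f hf => by
    have := hVD hf (P.conj (σ ^ (-(i : ℤ))))
    rwa [Divisor.apply_conj_zpow_neg hDσ, Finsupp.notMem_support_iff.1 (h𝓕D P hP),
      WithZero.exp_zero] at this
  refine ⟨fun P hP => h𝓕r P hP ▸ rank_quotient_vanishingSubspace_le hF V σ t P (hreg hP), ?_⟩
  intro W hWfin hW T
  have hDQ'0 : D Q' = 0 := Finsupp.notMem_support_iff.1 hDQ'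
  have hdet (b : Module.Basis (Fin s) k W) :
      (casorati σ fun i => ((b i : V) : F)).det ≠ 0 := by
    refine det_pow_apply_ne_zero σ _ (linearIndependent_of_rational_place hQ hQ' (V := V)
      (fun f hf => ?_) (fun f hf hlt => ?_) (fun i => (b i : V).2) ?_)
    · simpa [hDQ'0] using hVD hf Q'
    · have hmem : f ∈ V ⊓ Divisor.rrSpace (D - Finsupp.single Q' 1) := by
        refine ⟨hf, fun R => ?_⟩
        by_cases hR : R = Q'
        · subst hR
          simpa [hDQ'0] using lt_one_iff_le_exp_neg_one.1 hlt
        · simpa [Finsupp.single_apply, Ne.symm hR] using hVD hf R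
      rwa [hV, Submodule.mem_bot] at hmem
    · exact linearIndependent_coe_coe b.linearIndependent
  -- The choice of `⊥` is immaterial; only a basis indexed by `Fin s` is needed.
  obtain ⟨b, -⟩ : ∃ b : Module.Basis (Fin s) k W, _ := exists_basis_of_submodule (E := W) hW ⊥
  set Δ := (casorati σ fun i => ((b i : V) : F)).det with hΔ
  let d (P : 𝓕) : ℕ := Module.finrank k ↥(W ⊓ vanishingSubspace V σ t (P : Place k F))
  let p (x : 𝓕 × ℕ) : Place k F := (x.1 : Place k F).conj (σ ^ (-(x.2 : ℤ)))
  let I : Finset (𝓕 × ℕ) := T ×ˢ Finset.range (t - s + 1)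
  have hIt {x : 𝓕 × ℕ} (hx : x ∈ I) : x.2 + s ≤ t := by
    have := (Finset.mem_product.1 hx).2
    rw [Finset.mem_range] at this
    omega
  have hval {x : 𝓕 × ℕ} (hx : x ∈ I) :
      (p x).valuation Δ ≤ WithZero.exp (-(d x.1 : ℤ)) :=
    valuation_det_casorati_le (hreg x.1.2) W hW hdet b (hIt hx)
  -- Disjointness separates different orbits; `|S_P| = t` separates the conjugates of one `P`.
  have hinj : Set.InjOn p I := by
    rintro ⟨P, i⟩ hx ⟨R, j⟩ hy h
    have hi := hIt hx
    have hj := hIt hy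
    simp only [p] at h hi hj
    have hPR : P = R := by
      by_contra hne
      have := h𝓕disj P.2 R.2 fun e => hne (Subtype.ext e)
      exact Set.disjoint_left.1 this ⟨i, by omega, rfl⟩ ⟨j, by omega, h⟩
    subst hPR
    have hcard := h𝓕t P P.2
    rw [Place.orbitSet_eq_image, ← Finset.coe_image, Set.ncard_coe_finset] at hcard
    have hinj := Finset.card_image_iff.1 (hcard.trans (Finset.card_range t).symm)
    rw [hinj (by simp; omega) (by simp; omega) h]
  -- The order of `Δ` at `R`. Truncation at `0` is harmless on the chosen places, where the order is
  -- at least `d ≥ 0`.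
  let m (R : Place k F) : ℕ := (-WithZero.log (R.valuation Δ)).toNat
  have hlog {x : 𝓕 × ℕ} (hx : x ∈ I) : (d x.1 : ℤ) ≤ -WithZero.log ((p x).valuation Δ) := by
    have := (WithZero.log_le_iff_le_exp ((Valuation.ne_zero_iff _).2 (hdet b))).2 (hval hx)
    linarith
  have hbound := hF.sum_mul_degree_le_degree hconst (hdet b) (nsmul_nonneg hD s)
    (Divisor.det_casorati_mem_rrSpace hDσ fun i => hVD (b i : V).2) (I.image p) m (by
      intro R hR
      obtain ⟨x, hx, rfl⟩ := Finset.mem_image.1 hR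
      have := hlog hx
      refine WithZero.le_exp_of_log_le ?_
      simp only [m]
      rw [Int.toNat_of_nonneg (by omega), neg_neg])
  rw [Finset.sum_image hinj, Divisor.degree_nsmul] at hbound
  have hle : (∑ P ∈ T, d P) * (r * (t - s + 1)) ≤ ∑ x ∈ I, m (p x) * (p x).degree := by
    calc (∑ P ∈ T, d P) * (r * (t - s + 1)) = ∑ x ∈ I, d x.1 * r := by
          rw [Finset.sum_product, Finset.sum_mul]
          refine Finset.sum_congr rfl fun P _ => ?_
          simp only [Finset.sum_const, Finset.card_range, smul_eq_mul]
          ring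
      _ ≤ _ := Finset.sum_le_sum fun x hx => by
          rw [Place.degree_conj, h𝓕r _ x.1.2]
          refine Nat.mul_le_mul_right _ ?_
          have := hlog hx
          simp only [m]
          omega
  have hfinal : ((∑ P ∈ T, d P : ℕ) : ℝ) * (r * ((t : ℝ) - s + 1)) ≤ D.degree * s := by
    have h1 : (((∑ P ∈ T, d P) * (r * (t - s + 1)) : ℕ) : ℤ) ≤ s * D.degree :=
      (Int.ofNat_le.2 hle).trans hbound
    have h2 : ((((∑ P ∈ T, d P) * (r * (t - s + 1)) : ℕ) : ℤ) : ℝ) ≤ ((s * D.degree : ℤ) : ℝ) :=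
      Int.cast_le.2 h1
    push_cast [Nat.cast_sub hst] at h2 ⊢
    linarith
  have hts : (0 : ℝ) < (t : ℝ) - s + 1 := by
    have : (s : ℝ) ≤ t := by exact_mod_cast hst
    linarith
  -- Positivity of `r`, needed to divide, comes from an actual place in `T`. For empty `T`
  -- nonnegativity of the bound is enough.
  rcases T.eq_empty_or_nonempty with rfl | ⟨P, -⟩
  · have : (0 : ℝ) ≤ D.degree := by exact_mod_cast Divisor.degree_nonneg hD
    simp only [Finset.sum_empty]
    positivity
  · have hr : (0 : ℝ) < r := by
      have := hF.degree_pos (P : Place k F)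
      rw [h𝓕r P P.2] at this
      exact_mod_cast this
    rw [le_div_iff₀ (by positivity)]
    simpa [d] using hfinal
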